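/- Let $0<a<1$ be real and let $p_n = 1/(n+1)^a$ for $n\in\mathbb N$. For each $n$, draw a random graph $R$ on $\{0,1,\dots,n-1\}$ in which each pair $\{i,j\}$ with $i\neq j$ is an edge with probability $p_n$, independently for different pairs. Let $M_n=(\{0,\dots,n-1\},<,<^*)$, where $<$ is the usual order and $x<^*y$ holds if and only if there are $k\ge 1$ and $x=x_0<x_1<\dots<x_k=y$ in $\{0,\dots,n-1\}$ such that $x_\ell R x_{\ell+1}$ for all $\ell<k$; the relation $R$ itself is not part of the structure $M_n$. Then the sequence of random structures $M_n$ satisfies the very weak 0-1 law for first-order logic: for every first-order sentence $\varphi$ in the vocabulary $\{<,<^*\}$ (with equality), $$\lim_{n\to\infty}\bigl(\mathrm{Prob}(M_{n+1}\models\varphi)-\mathrm{Prob}(M_n\models\varphi)\bigr)=0 .$$ -/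

import Mathlib

open FirstOrder FirstOrder.Language Filter Topology

namespace RandomOrder

/-- The two binary relation symbols: `lt` for the linear order `<` and `ltStar` for `<*`. -/
inductive Rel : ℕ → Type
  | lt : Rel 2
  | ltStar : Rel 2

/-- The relational vocabulary with the two binary predicates `<` and `<*`. -/
def vocabulary : FirstOrder.Language.{0, 0} := ⟨fun _ => Empty, Rel⟩

/-- `x <* y`: for some `k ≥ 1` there are `x = x₀ < x₁ < ⋯ < x_k = y` with each pair
`x_l, x_{l+1}` an edge of `G`. -/
def LtStar {n : ℕ} (G : SimpleGraph (Fin n)) : Fin n → Fin n → Prop :=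
  Relation.TransGen fun x y => x < y ∧ G.Adj x y

/-- The structure `(n, <, <*)` on `{0, …, n-1}` obtained from a graph `G`; the edge relation of `G`
is not part of the vocabulary. -/
@[reducible]
def model {n : ℕ} (G : SimpleGraph (Fin n)) : vocabulary.Structure (Fin n) where
  funMap f := nomatch f
  RelMap
    | Rel.lt => fun v => v 0 < v 1
    | Rel.ltStar => fun v => LtStar G (v 0) (v 1)

/-- `Prob (M_n ⊨ φ)`, where `M_n = (n, <, <*)` comes from a random graph on `{0, …, n-1}` whose
edges are drawn independently, each with probability `p n`. -/
noncomputable def prob (p : ℕ → unitInterval) (n : ℕ) (φ : vocabulary.Sentence) : ℝ :=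
  (SimpleGraph.binomialRandom (Fin n) (p n)).real
    {G | @Sentence.Realize vocabulary (Fin n) (model G) φ}

/-- The very weak 0-1 law for first-order sentences, for a sequence of random models in which the
`n`-th one satisfies a sentence `φ` with probability `P n φ`. -/
def VeryWeakZeroOneLaw {L : FirstOrder.Language.{0, 0}} (P : ℕ → L.Sentence → ℝ) : Prop :=
  ∀ φ : L.Sentence, Tendsto (fun n : ℕ => P (n + 1) φ - P n φ) atTop (𝓝 0)

/-- The edge probability `p_n = 1 / (n + 1) ^ a`. -/
noncomputable def edgeProb (a : ℝ) (ha : 0 < a) (n : ℕ) : unitInterval :=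
  ⟨1 / ((n : ℝ) + 1) ^ a, by positivity, by
    have h : (1 : ℝ) ≤ ((n : ℝ) + 1) ^ a :=
      Real.one_le_rpow (by linarith [Nat.cast_nonneg (α := ℝ) n]) ha.le
    exact div_le_one_of_le₀ h (by positivity)⟩

end RandomOrder

set_option linter.unusedSectionVars false

/-! The heart of the matter is that adding or deleting one vertex has small influence on a
first-order sentence, by circuit complexity. Suppose that `<*` only had to take into account paths
of w = O(log² n) steps. Fix the edges on m = 2(n+1) vertices and regard the truth of φ in the
substructure induced on {v | s v = true} as a Boolean function of s. Quantifiers become disjunctions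
and conjunctions over the m vertices and `<*` becomes a DNF of width w, so the function is a circuit
of bounded depth, polynomial size and polylogarithmic bottom fan-in. By the switching lemma
(`switching_aux`, `simplifies_relRealize`) random restrictions turn it into a shallow decision tree,
so its total influence is polylogarithmic (`Simplifies.sum_sens_le`).

The structure induced on a set S is distributed like the model on |S| vertices with the same edge
probability. Hence the change Δ of the probability of φ between n and n+1 vertices is at most the
probability that deleting a given v from a given S with |S| = n+1 matters. Such S form the middle
layer of the cube, a fraction of order 1/√n, and each offers n+1 choices of v. So the total
influence is at least of order √n Δ, and Δ is at most polylog(n)/√n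
(`exists_abs_truncProb_succ_sub_le`).

Two approximations complete the proof. With high probability every path can be shortened to O(log²
n) steps (`longProb_le`): inside a short window long paths are unlikely, and for distant a and b the
set reachable from a and the set reaching b double block by block until they are so large that an
edge must join them. Passing from p_n to p_{n+1} changes the law of about n² coins by a chi-square
distance of order n²(p_n - p_{n+1})²/p_n, which is O(p_n) and tends to 0
(`abs_expect_bern_sub_sq_le`). -/

namespace RandomOrder

/-! ### Expectations of finite products -/

open Classical in
/-- The indicator of a proposition, as a real number. -/
noncomputable def ind (P : Prop) : ℝ := if P then 1 else 0

lemma ind_of {P : Prop} (h : P) : ind P = 1 := if_pos h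

lemma ind_not {P : Prop} (h : ¬P) : ind P = 0 := if_neg h

lemma ind_nonneg (P : Prop) : 0 ≤ ind P := by
  unfold ind; split_ifs <;> norm_num

lemma ind_le_one (P : Prop) : ind P ≤ 1 := by
  unfold ind; split_ifs <;> norm_num

lemma ind_mono {P Q : Prop} (h : P → Q) : ind P ≤ ind Q := by
  by_cases hP : P
  · rw [ind_of hP, ind_of (h hP)]
  · rw [ind_not hP]; exact ind_nonneg Q

lemma ind_or_le (P Q : Prop) : ind (P ∨ Q) ≤ ind P + ind Q := by
  by_cases hP : P
  · rw [ind_of (Or.inl hP), ind_of hP]; linarith [ind_nonneg Q]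
  · by_cases hQ : Q
    · rw [ind_of (Or.inr hQ), ind_of hQ]; linarith [ind_nonneg P]
    · rw [ind_not (by tauto), ind_not hP, ind_not hQ]; simp

lemma ind_and_add_ind_and_le {P Q R : Prop} (h : ¬(Q ∧ R)) :
    ind (P ∧ Q) + ind (P ∧ R) ≤ ind P := by
  by_cases hP : P <;> by_cases hQ : Q <;> by_cases hR : R <;> simp_all [ind]

lemma ind_exists_le_sum {ι : Type*} [Fintype ι] (P : ι → Prop) :
    ind (∃ i, P i) ≤ ∑ i, ind (P i) := by
  by_cases h : ∃ i, P i
  · obtain ⟨i, hi⟩ := h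
    rw [ind_of ⟨i, hi⟩, ← ind_of hi]
    exact Finset.single_le_sum (f := fun i => ind (P i)) (fun i _ => ind_nonneg _)
      (Finset.mem_univ i)
  · rw [ind_not h]; exact Finset.sum_nonneg fun i _ => ind_nonneg _

section Expect

variable {I J A B : Type*} [Fintype I] [DecidableEq I] [Fintype J] [DecidableEq J]
  [Fintype A] [Fintype B] [DecidableEq B]

/-- The integral of `h` against the product of the weights `c i`. -/
noncomputable def expect (c : I → A → ℝ) (h : (I → A) → ℝ) : ℝ :=
  ∑ x : I → A, (∏ i, c i (x i)) * h x

lemma expect_mono {c : I → A → ℝ} (hc : ∀ i a, 0 ≤ c i a) {h h' : (I → A) → ℝ}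
    (hh : ∀ x, h x ≤ h' x) : expect c h ≤ expect c h' :=
  Finset.sum_le_sum fun x _ =>
    mul_le_mul_of_nonneg_left (hh x) (Finset.prod_nonneg fun i _ => hc i _)

lemma expect_nonneg {c : I → A → ℝ} (hc : ∀ i a, 0 ≤ c i a) {h : (I → A) → ℝ}
    (hh : ∀ x, 0 ≤ h x) : 0 ≤ expect c h :=
  Finset.sum_nonneg fun x _ => mul_nonneg (Finset.prod_nonneg fun i _ => hc i _) (hh x)

lemma expect_add (c : I → A → ℝ) (h h' : (I → A) → ℝ) :
    expect c (fun x => h x + h' x) = expect c h + expect c h' := by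
  simp only [expect, mul_add, Finset.sum_add_distrib]

lemma expect_sub (c : I → A → ℝ) (h h' : (I → A) → ℝ) :
    expect c (fun x => h x - h' x) = expect c h - expect c h' := by
  simp only [expect, mul_sub, Finset.sum_sub_distrib]

lemma expect_const_mul (c : I → A → ℝ) (k : ℝ) (h : (I → A) → ℝ) :
    expect c (fun x => k * h x) = k * expect c h := by
  simp only [expect, Finset.mul_sum]
  exact Finset.sum_congr rfl fun x _ => by ring

lemma expect_sum {κ : Type*} (s : Finset κ) (c : I → A → ℝ) (h : κ → (I → A) → ℝ) :
    expect c (fun x => ∑ j ∈ s, h j x) = ∑ j ∈ s, expect c (h j) := by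
  simp only [expect, Finset.mul_sum]
  exact Finset.sum_comm

lemma expect_prod (c g : I → A → ℝ) :
    expect c (fun x => ∏ i, g i (x i)) = ∏ i, ∑ a, c i a * g i a := by
  simp only [expect, ← Finset.prod_mul_distrib]
  rw [Finset.prod_univ_sum, Fintype.piFinset_univ]

lemma expect_one {c : I → A → ℝ} (hc : ∀ i, ∑ a, c i a = 1) : expect c (fun _ => 1) = 1 := by
  have := expect_prod c (fun _ _ => 1)
  simpa [hc] using this

lemma expect_const {c : I → A → ℝ} (hc : ∀ i, ∑ a, c i a = 1) (k : ℝ) :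
    expect c (fun _ => k) = k := by
  have := expect_const_mul c k (fun _ => 1)
  rw [expect_one hc] at this
  simpa using this

lemma expect_le_one {c : I → A → ℝ} (h0 : ∀ i a, 0 ≤ c i a) (hc : ∀ i, ∑ a, c i a = 1)
    (h : (I → A) → ℝ) (hh : ∀ x, h x ≤ 1) : expect c h ≤ 1 := by
  rw [← expect_one hc]
  exact expect_mono h0 hh

lemma abs_expect_le {c : I → A → ℝ} (h0 : ∀ i a, 0 ≤ c i a) (h : (I → A) → ℝ) :
    |expect c h| ≤ expect c fun x => |h x| := by
  refine (Finset.abs_sum_le_sum_abs _ _).trans (le_of_eq ?_)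
  refine Finset.sum_congr rfl fun x _ => ?_
  rw [abs_mul, abs_of_nonneg (Finset.prod_nonneg fun i _ => h0 i _)]

lemma expect_union {κ : Type*} [Fintype κ] {c : I → A → ℝ} (h0 : ∀ i a, 0 ≤ c i a)
    {E : (I → A) → Prop} {E' : κ → (I → A) → Prop} (hE : ∀ x, E x → ∃ j, E' j x) :
    expect c (fun x => ind (E x)) ≤ ∑ j, expect c (fun x => ind (E' j x)) := by
  rw [← expect_sum]
  exact expect_mono h0 fun x => (ind_mono (hE x)).trans (ind_exists_le_sum _)

/-- The image of a product weight under a coordinatewise map. -/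
lemma expect_map (c : I → A → ℝ) (π : A → B) (h : (I → B) → ℝ) :
    expect c (fun x => h fun i => π (x i)) =
      expect (fun i b => ∑ a, if π a = b then c i a else 0) h := by
  have key : ∀ y : I → B, ∏ i, (∑ a, if π a = y i then c i a else 0) =
      ∑ x : I → A, if (fun i => π (x i)) = y then ∏ i, c i (x i) else 0 := by
    intro y
    rw [Finset.prod_univ_sum, Fintype.piFinset_univ]
    refine Finset.sum_congr rfl fun x _ => ?_
    split_ifs with hx
    · refine Finset.prod_congr rfl fun i _ => ?_
      rw [if_pos (congrFun hx i)]
    · obtain ⟨i, hi⟩ := Function.ne_iff.1 hx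
      exact Finset.prod_eq_zero (Finset.mem_univ i) (if_neg hi)
  simp only [expect, key, Finset.sum_mul]
  rw [Finset.sum_comm]
  refine Finset.sum_congr rfl fun x _ => ?_
  simp only [ite_mul, zero_mul]
  rw [Finset.sum_ite_eq]
  simp

/-- Two independent families of coordinates form one family of independent pairs. Together with
`expect_map` this computes the law of composed restrictions. -/
lemma expect_expect (c : I → A → ℝ) (d : I → B → ℝ) (h : (I → A) → (I → B) → ℝ) :
    expect c (fun x => expect d fun y => h x y) =
      expect (fun i (z : A × B) => c i z.1 * d i z.2)
        (fun z => h (fun i => (z i).1) (fun i => (z i).2)) := by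
  simp only [expect, Finset.mul_sum]
  rw [← Fintype.sum_prod_type', ← (Equiv.arrowProdEquivProdArrow I (fun _ => A) (fun _ => B)).sum_comp]
  refine Finset.sum_congr rfl fun z _ => ?_
  rw [Finset.prod_mul_distrib]
  simp [Equiv.arrowProdEquivProdArrow, mul_assoc]

open Classical in
lemma expect_forall_mem {c : I → A → ℝ} (hc : ∀ i, ∑ a, c i a = 1) (T : Finset I) (b : I → A) :
    expect c (fun x => ind (∀ i ∈ T, x i = b i)) = ∏ i ∈ T, c i (b i) := by
  have h1 : ∀ x : I → A, ind (∀ i ∈ T, x i = b i) =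
      ∏ i, if i ∈ T then (if x i = b i then (1 : ℝ) else 0) else 1 := by
    intro x
    by_cases h : ∀ i ∈ T, x i = b i
    · rw [ind_of h, Finset.prod_eq_one]
      intro i _
      split_ifs with h1 h2 <;> simp_all
    · rw [ind_not h]
      push Not at h
      obtain ⟨i, hi, hne⟩ := h
      exact (Finset.prod_eq_zero (Finset.mem_univ i) (by rw [if_pos hi, if_neg hne])).symm
  simp only [h1]
  rw [expect_prod c (fun i a => if i ∈ T then (if a = b i then (1 : ℝ) else 0) else 1)]
  rw [← Finset.prod_subset (Finset.subset_univ T)]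
  · refine Finset.prod_congr rfl fun i hi => ?_
    simp [hi]
  · intro i _ hi
    simp [hi, hc]

open Classical in
/-- The marginal of a product of probability weights. -/
lemma expect_comp_injective {c : J → A → ℝ} (hc : ∀ j, ∑ a, c j a = 1) {ι : I → J}
    (hι : Function.Injective ι) (h : (I → A) → ℝ) :
    expect c (fun x => h fun i => x (ι i)) = expect (fun i => c (ι i)) h := by
  have h1 : ∀ x : J → A, h (fun i => x (ι i)) =
      ∑ y : I → A, h y * ind (∀ i, x (ι i) = y i) := by
    intro x
    rw [Finset.sum_eq_single (fun i => x (ι i))]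
    · rw [ind_of fun _ => rfl, mul_one]
    · intro y _ hy
      rw [ind_not, mul_zero]
      intro hxy
      exact hy (funext fun i => (hxy i).symm)
    · simp
  simp only [h1]
  rw [expect_sum]
  refine Finset.sum_congr rfl fun y _ => ?_
  rw [expect_const_mul, mul_comm]
  congr 1
  by_cases hI : Nonempty A
  · obtain ⟨a₀⟩ := hI
    have h2 : ∀ x : J → A, (∀ i, x (ι i) = y i) ↔
        ∀ j ∈ Finset.univ.image ι, x j = Function.extend ι y (fun _ => a₀) j := by
      intro x
      simp [hι.extend_apply]
    simp only [h2]
    rw [expect_forall_mem hc, Finset.prod_image fun _ _ _ _ e => hι e]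
    simp [hι.extend_apply]
  · have : IsEmpty A := not_nonempty_iff.1 hI
    have : IsEmpty J := ⟨fun j => by simpa using hc j⟩
    have : IsEmpty I := ⟨fun i => this.elim (ι i)⟩
    simp [expect, ind]

end Expect

/-! ### Restrictions and decision trees -/

section DecisionTrees

variable {V : Type*} [DecidableEq V]

/-- The assignment which agrees with the partial assignment `ρ` where that is defined, and with `x`
elsewhere. -/
def fill (ρ : V → Option Bool) (x : V → Bool) : V → Bool := fun v => (ρ v).getD (x v)

/-- The partial assignment which agrees with `σ` where that is defined, and with `ρ` elsewhere. -/
def comb (σ ρ : V → Option Bool) : V → Option Bool := fun v => (σ v).or (ρ v)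

lemma fill_comb (σ ρ : V → Option Bool) (x : V → Bool) :
    fill (comb σ ρ) x = fill σ (fill ρ x) := by
  funext v
  cases h : σ v <;> simp [fill, comb, h]

lemma fill_of_some {ρ : V → Option Bool} {v : V} {b : Bool} (h : ρ v = some b) (x : V → Bool) :
    fill ρ x v = b := by simp [fill, h]

lemma fill_of_none {ρ : V → Option Bool} {v : V} (h : ρ v = none) (x : V → Bool) :
    fill ρ x v = x v := by simp [fill, h]

lemma fill_update_of_none {ρ : V → Option Bool} {v : V} (h : ρ v = none) (x : V → Bool) (b : Bool) :
    fill ρ (Function.update x v b) = Function.update (fill ρ x) v b := by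
  funext u
  by_cases hu : u = v
  · subst hu; simp [fill, h]
  · simp [fill, hu]

/-- `HasDT k f`: the property `f` of Boolean assignments is computed by a decision tree of depth at
most `k`. -/
inductive HasDT : ℕ → ((V → Bool) → Prop) → Prop
  | const (n : ℕ) (P : Prop) : HasDT n fun _ => P
  | node {n : ℕ} {f : (V → Bool) → Prop} (v : V)
      (h : ∀ b, HasDT n fun x => f (Function.update x v b)) : HasDT (n + 1) f

lemma HasDT.mono {k : ℕ} {f : (V → Bool) → Prop} (h : HasDT k f) :
    ∀ {l : ℕ}, k ≤ l → HasDT l f := by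
  induction h with
  | const n P => exact fun _ => .const _ P
  | node v _ ih =>
    intro l hl
    obtain ⟨l, rfl⟩ : ∃ l', l = l' + 1 := ⟨l - 1, by omega⟩
    exact .node v fun b => ih b (by omega)

lemma HasDT.not {k : ℕ} {f : (V → Bool) → Prop} (h : HasDT k f) : HasDT k fun x => ¬f x := by
  induction h with
  | const n P => exact .const n _
  | node v _ ih => exact .node v ih

/-- Queries to variables fixed by `ρ` are skipped, so the depth cannot grow. -/
lemma HasDT.restrict {k : ℕ} {f : (V → Bool) → Prop} (h : HasDT k f) (ρ : V → Option Bool) :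
    HasDT k fun x => f (fill ρ x) := by
  induction h with
  | const n P => exact .const n _
  | @node n f v _ ih =>
    cases hv : ρ v with
    | none =>
      refine .node v fun b => ?_
      simp only [fill_update_of_none hv]
      exact ih b
    | some b =>
      have : ∀ x, Function.update (fill ρ x) v b = fill ρ x := fun x => by
        rw [← fill_of_some hv x, Function.update_eq_self]
      have h1 := ih b
      simp only [this] at h1
      exact h1.mono (Nat.le_succ n)

lemma HasDT.literal (v : V) : HasDT 1 fun x : V → Bool => x v = true := by
  refine .node v fun b => ?_
  simp only [Function.update_self]
  exact .const _ _

/-- All of `Y` is queried in turn, and then the tree belonging to the answers `π` is followed. -/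
lemma HasDT.of_query (Y : Finset V) {k : ℕ} {f : (V → Bool) → Prop}
    (h : ∀ π : V → Option Bool, (∀ v, π v ≠ none ↔ v ∈ Y) → HasDT k fun x => f (fill π x)) :
    HasDT (k + Y.card) f := by
  induction Y using Finset.induction_on generalizing f with
  | empty => exact h (fun _ => none) (by simp)
  | insert v Y hv ih =>
    rw [Finset.card_insert_of_notMem hv, ← add_assoc]
    refine .node v fun b => ih fun π hπ => ?_
    have h1 := h (Function.update π v (some b)) (by
      intro u
      by_cases hu : u = v
      · subst hu; simp
      · simp [hu, hπ])
    convert h1 using 3 with x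
    funext u
    by_cases hu : u = v
    · subst hu; simp [fill]
    · simp [fill, hu]

/-- `x` satisfies the conjunction of literals given by `τ`. -/
def Sat (τ : V → Option Bool) (x : V → Bool) : Prop := ∀ v b, τ v = some b → x v = b

/-- The number of literals of a term is at most `k`. -/
def WidthLE (k : ℕ) (τ : V → Option Bool) : Prop :=
  ∃ U : Finset V, U.card ≤ k ∧ ∀ v, τ v ≠ none → v ∈ U

/-- `f` is a disjunction of terms with at most `k` literals. -/
def IsDNF (k : ℕ) (f : (V → Bool) → Prop) : Prop :=
  ∀ s, f s → ∃ τ, WidthLE k τ ∧ Sat τ s ∧ ∀ s', Sat τ s' → f s'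

/-- The term for `s` records the answers along the branch that `s` follows. -/
lemma HasDT.isDNF {k : ℕ} {f : (V → Bool) → Prop} (h : HasDT k f) : IsDNF k f := by
  induction h with
  | const n P =>
    intro s hs
    exact ⟨fun _ => none, ⟨∅, by simp, by simp⟩, by simp [Sat], fun _ _ => hs⟩
  | @node n f v _ ih =>
    intro s hs
    obtain ⟨τ, ⟨U, hU, hτU⟩, hsat, himp⟩ := ih (s v) s (by simpa using hs)
    refine ⟨Function.update τ v (some (s v)), ⟨insert v U, ?_, ?_⟩, ?_, ?_⟩
    · exact (Finset.card_insert_le _ _).trans (by omega)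
    · intro u hu
      by_cases huv : u = v
      · simp [huv]
      · exact Finset.mem_insert_of_mem (hτU u (by simpa [huv] using hu))
    · intro u b hub
      by_cases huv : u = v
      · subst huv; simpa using hub
      · exact hsat u b (by simpa [huv] using hub)
    · intro s' hs'
      have hv : s' v = s v := hs' v _ (by simp)
      have h1 := himp s' (by
        intro u b hub
        by_cases huv : u = v
        · subst huv; rw [hv]; exact hsat u b hub
        · exact hs' u b (by simpa [huv] using hub))
      rwa [← hv, Function.update_eq_self] at h1

lemma IsDNF.exists {ι : Type*} {k : ℕ} {f : ι → (V → Bool) → Prop} (h : ∀ i, IsDNF k (f i)) :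
    IsDNF k fun s => ∃ i, f i s := by
  rintro s ⟨i, hi⟩
  obtain ⟨τ, hw, hs, himp⟩ := h i s hi
  exact ⟨τ, hw, hs, fun s' hs' => ⟨i, himp s' hs'⟩⟩

lemma IsDNF.mono {k l : ℕ} (hkl : k ≤ l) {f : (V → Bool) → Prop} (h : IsDNF k f) : IsDNF l f := by
  intro s hs
  obtain ⟨τ, ⟨U, hU, hτU⟩, hsat, himp⟩ := h s hs
  exact ⟨τ, ⟨U, hU.trans hkl, hτU⟩, hsat, himp⟩

/-- The value of `f` changes when the value at `v` is flipped. -/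
def Sens (f : (V → Bool) → Prop) (v : V) (s : V → Bool) : Prop :=
  ¬(f (Function.update s v (!s v)) ↔ f s)

/-- Only the variables queried on the branch of `s` can be sensitive at `s`. -/
lemma HasDT.sum_sens_le [Fintype V] {k : ℕ} {f : (V → Bool) → Prop} (h : HasDT k f)
    (s : V → Bool) : ∑ v, ind (Sens f v s) ≤ k := by
  induction h with
  | const n P => simp [Sens, ind]
  | @node n f v _ ih =>
    have h1 : ∀ u, ind (Sens f u s) ≤
        ind (u = v) + ind (Sens (fun x => f (Function.update x v (s v))) u s) := by
      intro u
      refine le_trans (ind_mono fun hu => ?_) (ind_or_le _ _)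
      by_cases huv : u = v
      · exact Or.inl huv
      · right
        unfold Sens at hu ⊢
        beta_reduce
        rw [Function.update_eq_self]
        have h2 : Function.update (Function.update s u (!s u)) v (s v) =
            Function.update s u (!s u) := by
          funext a
          by_cases ha : a = v
          · subst ha; simp [Function.update_of_ne (Ne.symm huv)]
          · simp [Function.update_of_ne ha]
        rwa [h2]
    have h2 : ∑ u, ind (u = v) = 1 := by
      rw [Finset.sum_eq_single v] <;> simp +contextual [ind]
    calc ∑ u, ind (Sens f u s) ≤ ∑ u, (ind (u = v) +
          ind (Sens (fun x => f (Function.update x v (s v))) u s)) :=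
          Finset.sum_le_sum fun u _ => h1 u
      _ ≤ 1 + n := by
          rw [Finset.sum_add_distrib, h2]
          linarith [ih (s v)]
      _ = ((n + 1 : ℕ) : ℝ) := by push_cast; ring

end DecisionTrees

/-! ### The switching lemma -/

section Switching

variable {V : Type*} [Fintype V] [DecidableEq V]

/-- The law of a random restriction at one point: undefined with probability `q`, and otherwise a
fair coin. -/
noncomputable def starWt (q : ℝ) : Option Bool → ℝ
  | none => q
  | some _ => (1 - q) / 2

lemma starWt_nonneg {q : ℝ} (h0 : 0 ≤ q) (h1 : q ≤ 1) (o : Option Bool) : 0 ≤ starWt q o := by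
  cases o <;> simp only [starWt] <;> linarith

lemma sum_starWt (q : ℝ) : ∑ o, starWt q o = 1 := by
  simp [starWt, Fintype.sum_option]; ring

/-- A variable stays free if it survives both rounds, and the remaining mass is split evenly between
the two values. So rounds of restrictions compose by multiplying their rates. -/
lemma expect_starWt_comb (q r : ℝ) (h : (V → Option Bool) → ℝ) :
    expect (fun _ => starWt q) (fun ρ => expect (fun _ => starWt r) fun ρ' => h (comb ρ ρ')) =
      expect (fun _ => starWt (q * r)) h := by
  rw [expect_expect]
  refine (expect_map _ (fun z : Option Bool × Option Bool => z.1.or z.2) h).trans ?_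
  congr 1
  funext _ o
  rw [Fintype.sum_prod_type]
  rcases o with _ | _ | _ <;> simp [starWt, Fintype.sum_option] <;> ring

/-- Every decision tree for `f` has depth at least `s`. -/
def DTDepthGE (s : ℕ) (f : (V → Bool) → Prop) : Prop := ∀ k, HasDT k f → s ≤ k

/-- Setting the free variables of `Y` to the values of `τ` is injective on `E`, and each one set
trades a weight `q` for `(1 - q) / 2`, that is, for `q / β`. -/
lemma expect_starWt_le_of_fix {q β : ℝ} (h0 : 0 ≤ q) (h1 : q ≤ 1) (hβ : 0 ≤ β)
    (hq : q = β * ((1 - q) / 2)) (Y : Finset V) (τ : V → Option Bool) (hτ : ∀ v ∈ Y, τ v ≠ none)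
    {E E' : (V → Option Bool) → Prop} (hY : ∀ ρ, E ρ → ∀ v ∈ Y, ρ v = none)
    (hE : ∀ ρ, E ρ → E' fun v => if v ∈ Y then τ v else ρ v) :
    expect (fun _ => starWt q) (fun ρ => ind (E ρ)) ≤
      β ^ Y.card * expect (fun _ => starWt q) (fun ρ => ind (E' ρ)) := by
  classical
  let φ : (V → Option Bool) → V → Option Bool := fun ρ v => if v ∈ Y then τ v else ρ v
  have hw : ∀ ρ, E ρ → ∏ v, starWt q (ρ v) = β ^ Y.card * ∏ v, starWt q (φ ρ v) := by
    intro ρ hρ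
    have h2 : β ^ Y.card = ∏ v, if v ∈ Y then β else 1 := by
      rw [Finset.prod_ite_mem, Finset.univ_inter, Finset.prod_const]
    rw [h2, ← Finset.prod_mul_distrib]
    refine Finset.prod_congr rfl fun v _ => ?_
    by_cases hv : v ∈ Y
    · obtain ⟨b, hb⟩ := Option.ne_none_iff_exists'.1 (hτ v hv)
      simp only [φ, if_pos hv, hY ρ hρ v hv, hb]
      simpa only [starWt] using hq
    · simp only [φ, if_neg hv, one_mul]
  have hinj : Set.InjOn φ (Finset.univ.filter E : Finset (V → Option Bool)) := by
    intro ρ hρ ρ' hρ' heq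
    have hρ := (Finset.mem_filter.1 hρ).2
    have hρ' := (Finset.mem_filter.1 hρ').2
    funext v
    by_cases hv : v ∈ Y
    · rw [hY ρ hρ v hv, hY ρ' hρ' v hv]
    · simpa [φ, hv] using congrFun heq v
  have hsum : ∀ E : (V → Option Bool) → Prop, expect (fun _ => starWt q) (fun ρ => ind (E ρ)) =
      ∑ ρ ∈ Finset.univ.filter E, ∏ v, starWt q (ρ v) := by
    intro E
    rw [Finset.sum_filter]
    refine Finset.sum_congr rfl fun ρ _ => ?_
    by_cases h : E ρ <;> simp [ind, h]
  rw [hsum, hsum, Finset.sum_congr rfl fun ρ hρ => hw ρ (Finset.mem_filter.1 hρ).2,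
    ← Finset.mul_sum, ← Finset.sum_image (f := fun ρ => ∏ v, starWt q (ρ v)) hinj]
  refine mul_le_mul_of_nonneg_left ?_ (pow_nonneg hβ _)
  refine Finset.sum_le_sum_of_subset_of_nonneg ?_ fun ρ _ _ =>
    Finset.prod_nonneg fun v _ => starWt_nonneg h0 h1 _
  intro ρ hρ
  obtain ⟨ρ', hρ', rfl⟩ := Finset.mem_image.1 hρ
  exact Finset.mem_filter.2 ⟨Finset.mem_univ _, hE ρ' (Finset.mem_filter.1 hρ').2⟩

/-- The disjunction of a list of terms. -/
def Dnf (F : List (V → Option Bool)) (x : V → Bool) : Prop := ∃ τ ∈ F, Sat τ x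

/-- Otherwise a tree that is too shallow exists: query the free variables of `τ`; answers agreeing
with `τ` make the DNF true, and all others falsify `τ` and leave `F`, which then has a tree of depth
less than `s` minus the number of queries. -/
lemma exists_answers_of_depthGE {F : List (V → Option Bool)} {τ ρ : V → Option Bool} {s : ℕ}
    (hs : 0 < s) (hbad : DTDepthGE s fun x => Dnf (τ :: F) (fill ρ x))
    (hF : ¬∃ v b, τ v = some b ∧ ρ v = some (!b)) :
    ∃ π : V → Option Bool, (∃ v, π v ≠ none) ∧ (∀ v, π v ≠ none ↔ τ v ≠ none ∧ ρ v = none) ∧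
      DTDepthGE (s - (Finset.univ.filter fun v => π v ≠ none).card)
        fun x => Dnf F (fill ρ (fill π x)) := by
  classical
  have hF' : ∀ v b, τ v = some b → ρ v ≠ none → ρ v = some b := by
    intro v b hv hρ
    obtain ⟨c, hc⟩ := Option.ne_none_iff_exists'.1 hρ
    by_contra hne
    refine hF ⟨v, b, hv, ?_⟩
    rw [hc, Option.some_inj] at hne
    rw [hc, Bool.eq_not.2 hne]
  set Y : Finset V := Finset.univ.filter fun v => τ v ≠ none ∧ ρ v = none with hYdef
  -- A term that is not falsified and has no free variable is satisfied, which would make the DNF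
  -- constant.
  have hYne : Y.Nonempty := by
    by_contra hemp
    rw [Finset.not_nonempty_iff_eq_empty, Finset.filter_eq_empty_iff] at hemp
    have htrue : ∀ x, Dnf (τ :: F) (fill ρ x) := by
      refine fun x => ⟨τ, List.mem_cons_self, fun v b hv => ?_⟩
      refine fill_of_some (hF' v b hv fun h0 => hemp (Finset.mem_univ v) ⟨by simp [hv], h0⟩) x
    have := hbad 0 (by simp only [htrue]; exact .const 0 True)
    omega
  have hcard : ∀ π : V → Option Bool, (∀ v, π v ≠ none ↔ v ∈ Y) →
      (Finset.univ.filter fun v => π v ≠ none) = Y := by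
    intro π hπ
    ext v
    rw [Finset.mem_filter, hπ v]
    simp
  by_contra hcon
  push Not at hcon
  have hgood : ∀ π : V → Option Bool, (∀ v, π v ≠ none ↔ v ∈ Y) →
      ∃ k < s - Y.card, HasDT k fun x => Dnf F (fill ρ (fill π x)) := by
    intro π hπ
    obtain ⟨v, hv⟩ := hYne
    have h1 := hcon π ⟨v, (hπ v).2 hv⟩ (by
      intro u
      rw [hπ u, hYdef, Finset.mem_filter]
      simp)
    rw [hcard π hπ] at h1
    unfold DTDepthGE at h1
    push Not at h1
    obtain ⟨k, hk, hlt⟩ := h1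
    exact ⟨k, hlt, hk⟩
  -- Positivity of this truncated difference makes the depth `s - Y.card - 1 + Y.card` below equal
  -- to `s - 1`.
  have hlt : 0 < s - Y.card := by
    obtain ⟨k, hk, _⟩ := hgood (fun v => if v ∈ Y then some true else none) (by
      intro v; by_cases hv : v ∈ Y <;> simp [hv])
    omega
  have key : HasDT (s - Y.card - 1 + Y.card) fun x => Dnf (τ :: F) (fill ρ x) := by
    refine HasDT.of_query Y fun π hπ => ?_
    by_cases hag : ∀ v ∈ Y, π v = τ v
    · have htrue : ∀ x, Dnf (τ :: F) (fill ρ (fill π x)) := by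
        refine fun x => ⟨τ, List.mem_cons_self, fun v b hv => ?_⟩
        by_cases h0 : ρ v = none
        · have hvY : v ∈ Y := by rw [hYdef, Finset.mem_filter]; simp [hv, h0]
          rw [fill_of_none h0]
          exact fill_of_some ((hag v hvY).trans hv) x
        · exact fill_of_some (hF' v b hv h0) _
      simp only [htrue]
      exact .const _ True
    · push Not at hag
      obtain ⟨v, hv, hne⟩ := hag
      have hv' := hv
      rw [hYdef, Finset.mem_filter] at hv'
      have hfalse : ∀ x, ¬Sat τ (fill ρ (fill π x)) := by
        intro x hsat
        obtain ⟨b, hb⟩ := Option.ne_none_iff_exists'.1 hv'.2.1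
        obtain ⟨c, hc⟩ := Option.ne_none_iff_exists'.1 ((hπ v).2 hv)
        have h1 := hsat v b hb
        rw [fill_of_none hv'.2.2, fill_of_some hc] at h1
        exact hne (by rw [hc, hb, h1])
      have heq : ∀ x, Dnf (τ :: F) (fill ρ (fill π x)) = Dnf F (fill ρ (fill π x)) := by
        intro x
        simp [Dnf, hfalse x]
      simp only [heq]
      obtain ⟨k, hk, hdt⟩ := hgood π hπ
      exact hdt.mono (by omega)
  have := hbad _ key
  omega

/-- Each variable of `U` is unset or takes one of two values, so the sum over all `π` supported in
`U` is `(1 + 2 * γ) ^ U.card`; leaving out the empty `π` subtracts 1. -/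
lemma sum_answers_le {γ : ℝ} {k : ℕ} {U : Finset V} (hU : U.card ≤ k) (hγ : 0 ≤ γ)
    (hk : (1 + 2 * γ) ^ k ≤ 2) :
    ∑ π ∈ Finset.univ.filter (fun π : V → Option Bool => (∃ v, π v ≠ none) ∧
      ∀ v, π v ≠ none → v ∈ U), γ ^ (Finset.univ.filter fun v => π v ≠ none).card ≤ 1 := by
  classical
  let g : V → Option Bool → ℝ := fun v o => if o = none then 1 else if v ∈ U then γ else 0
  have hg0 : ∀ v o, 0 ≤ g v o := by
    intro v o; simp only [g]; split_ifs <;> simp [hγ]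
  have h1 : ∑ π : V → Option Bool, ∏ v, g v (π v) = (1 + 2 * γ) ^ U.card := by
    rw [← Fintype.piFinset_univ, ← Finset.prod_univ_sum]
    have h2 : ∀ v, ∑ o, g v o = if v ∈ U then 1 + 2 * γ else 1 := by
      intro v
      by_cases hv : v ∈ U <;> simp [g, hv, Fintype.sum_option, two_mul]
    simp only [h2]
    rw [Finset.prod_ite_mem, Finset.univ_inter, Finset.prod_const]
  have h3 : ∏ v, g v ((fun _ => none : V → Option Bool) v) = 1 := by simp [g]
  have h4 : ∀ π : V → Option Bool, (∀ v, π v ≠ none → v ∈ U) →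
      γ ^ (Finset.univ.filter fun v => π v ≠ none).card = ∏ v, g v (π v) := by
    intro π hπ
    rw [← Finset.prod_const, Finset.prod_filter]
    refine Finset.prod_congr rfl fun v _ => ?_
    by_cases hv : π v = none
    · simp [g, hv]
    · simp [g, hv, hπ v hv]
  rw [Finset.sum_congr rfl fun π hπ => h4 π (Finset.mem_filter.1 hπ).2.2]
  have h5 : ∑ π ∈ Finset.univ.filter (fun π : V → Option Bool => (∃ v, π v ≠ none) ∧
      ∀ v, π v ≠ none → v ∈ U), ∏ v, g v (π v) + ∏ v, g v ((fun _ => none : V → Option Bool) v) ≤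
      ∑ π : V → Option Bool, ∏ v, g v (π v) := by
    rw [← Finset.sum_erase_add _ _ (Finset.mem_univ (fun _ => none : V → Option Bool))]
    refine add_le_add_left (Finset.sum_le_sum_of_subset_of_nonneg ?_ fun π _ _ =>
      Finset.prod_nonneg fun v _ => hg0 _ _) _
    intro π hπ
    obtain ⟨v, hv⟩ := (Finset.mem_filter.1 hπ).2.1
    refine Finset.mem_erase.2 ⟨fun h => hv (by rw [h]), Finset.mem_univ _⟩
  have h6 : (1 + 2 * γ) ^ U.card ≤ (1 + 2 * γ) ^ k := pow_le_pow_right₀ (by linarith) hU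
  linarith

/-- The switching lemma, relative to an event `A` that is preserved when more values are fixed. -/
theorem switching_aux {q α β : ℝ} {k : ℕ} (h0 : 0 ≤ q) (h1 : q ≤ 1) (hβ : 0 ≤ β) (hα : 0 < α)
    (hα1 : α ≤ 1) (hq : q = β * ((1 - q) / 2)) (hk : (1 + 2 * (β / α)) ^ k ≤ 2)
    (F : List (V → Option Bool)) (hF : ∀ τ ∈ F, WidthLE k τ) (A : (V → Option Bool) → Prop)
    (hA : ∀ ρ ρ', (∀ v b, ρ v = some b → ρ' v = some b) → A ρ → A ρ') (σ : V → Option Bool)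
    (s : ℕ) :
    expect (fun _ => starWt q) (fun ρ => ind (A ρ ∧ DTDepthGE s fun x => Dnf F (fill (comb σ ρ) x)))
      ≤ α ^ s * expect (fun _ => starWt q) (fun ρ => ind (A ρ)) := by
  classical
  have hw : ∀ (_ : V) o, 0 ≤ starWt q o := fun _ => starWt_nonneg h0 h1
  induction F generalizing A σ s with
  | nil =>
    rcases Nat.eq_zero_or_pos s with rfl | hs
    · rw [pow_zero, one_mul]
      exact expect_mono hw fun ρ => ind_mono And.left
    · have h2 : ∀ ρ, ind (A ρ ∧ DTDepthGE s fun x => Dnf [] (fill (comb σ ρ) x)) = 0 := by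
        intro ρ
        refine ind_not fun h => ?_
        have := h.2 0 (by simp only [Dnf, List.not_mem_nil, false_and, exists_false]; exact .const 0 _)
        omega
      simp only [h2]
      have h3 : expect (fun _ : V => starWt q) (fun _ => 0) = 0 := by simp [expect]
      rw [h3]
      exact mul_nonneg (pow_nonneg hα.le _) (expect_nonneg hw fun ρ => ind_nonneg _)
  | cons τ F ih =>
    have ih := ih fun τ' hτ' => hF τ' (List.mem_cons_of_mem _ hτ')
    rcases Nat.eq_zero_or_pos s with rfl | hs
    · rw [pow_zero, one_mul]
      exact expect_mono hw fun ρ => ind_mono And.left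
    obtain ⟨U, hU, hτU⟩ := hF τ List.mem_cons_self
    -- `Fa`: the first term is falsified; `Sa`: it is satisfied. Both persist when more values are
    -- fixed, so `A ∧ Fa` and `A ∧ Sa` are admissible events for the induction hypothesis.
    let Fa : (V → Option Bool) → Prop := fun ρ => ∃ v b, τ v = some b ∧ comb σ ρ v = some (!b)
    let Sa : (V → Option Bool) → Prop := fun ρ => ∀ v b, τ v = some b → comb σ ρ v = some b
    have hcomb : ∀ ρ ρ' : V → Option Bool, (∀ v b, ρ v = some b → ρ' v = some b) →
        ∀ v b, comb σ ρ v = some b → comb σ ρ' v = some b := by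
      intro ρ ρ' hρ v b
      cases hσ : σ v with
      | none => simpa [comb, hσ] using hρ v b
      | some c => simp [comb, hσ]
    have hFa : ∀ ρ ρ', (∀ v b, ρ v = some b → ρ' v = some b) → A ρ ∧ Fa ρ → A ρ' ∧ Fa ρ' := by
      rintro ρ ρ' hρ ⟨hAρ, v, b, hv, hc⟩
      exact ⟨hA ρ ρ' hρ hAρ, v, b, hv, hcomb ρ ρ' hρ _ _ hc⟩
    have hSa : ∀ ρ ρ', (∀ v b, ρ v = some b → ρ' v = some b) → A ρ ∧ Sa ρ → A ρ' ∧ Sa ρ' := by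
      rintro ρ ρ' hρ ⟨hAρ, hs⟩
      exact ⟨hA ρ ρ' hρ hAρ, fun v b hv => hcomb ρ ρ' hρ _ _ (hs v b hv)⟩
    let An : Finset (V → Option Bool) := Finset.univ.filter (fun π => (∃ v, π v ≠ none) ∧
      ∀ v, π v ≠ none → v ∈ U)
    let N : (V → Option Bool) → ℕ := fun π => (Finset.univ.filter fun v => π v ≠ none).card
    let Ev : (V → Option Bool) → (V → Option Bool) → Prop := fun π ρ =>
      A ρ ∧ ¬Fa ρ ∧ (∀ v, π v ≠ none ↔ τ v ≠ none ∧ comb σ ρ v = none) ∧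
        DTDepthGE (s - N π) fun x => Dnf F (fill (comb (comb σ π) ρ) x)
    -- Either the first term is falsified and drops out, or some nonempty set of answers `π` to its
    -- free variables leaves a deep function of the other terms.
    have hsplit : ∀ ρ, ind (A ρ ∧ DTDepthGE s fun x => Dnf (τ :: F) (fill (comb σ ρ) x)) ≤
        ind ((A ρ ∧ Fa ρ) ∧ DTDepthGE s fun x => Dnf F (fill (comb σ ρ) x)) +
          ∑ π ∈ An, ind (Ev π ρ) := by
      intro ρ
      have hnn : 0 ≤ ∑ π ∈ An, ind (Ev π ρ) := Finset.sum_nonneg fun π _ => ind_nonneg _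
      by_cases h : A ρ ∧ DTDepthGE s fun x => Dnf (τ :: F) (fill (comb σ ρ) x)
      · by_cases hf : Fa ρ
        · refine le_trans ?_ (le_add_of_nonneg_right hnn)
          refine ind_mono fun _ => ⟨⟨h.1, hf⟩, ?_⟩
          have heq : ∀ x, Dnf (τ :: F) (fill (comb σ ρ) x) = Dnf F (fill (comb σ ρ) x) := by
            intro x
            obtain ⟨v, b, hv, hc⟩ := hf
            have : ¬Sat τ (fill (comb σ ρ) x) := by
              intro hsat
              have h2 := hsat v b hv
              rw [fill_of_some hc] at h2
              cases b <;> simp at h2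
            simp [Dnf, this]
          have h2 := h.2
          simp only [heq] at h2
          exact h2
        · obtain ⟨π, hne, hπ, hbad⟩ := exists_answers_of_depthGE hs h.2 hf
          have hmem : π ∈ An := Finset.mem_filter.2
            ⟨Finset.mem_univ _, hne, fun v hv => hτU v ((hπ v).1 hv).1⟩
          have hev : Ev π ρ := by
            refine ⟨h.1, hf, hπ, ?_⟩
            convert hbad using 3 with x
            rw [← fill_comb]
            congr 1
            funext v
            by_cases hv : π v = none
            · simp [comb, hv]
            · have := ((hπ v).1 hv).2
              simp only [comb, Option.or_eq_none_iff] at this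
              simp [comb, this.1, this.2]
          refine (ind_le_one _).trans ?_
          rw [← ind_of hev]
          refine (Finset.single_le_sum (f := fun π => ind (Ev π ρ)) (fun π _ => ind_nonneg _)
            hmem).trans (le_add_of_nonneg_left (ind_nonneg _))
      · rw [ind_not h]
        exact add_nonneg (ind_nonneg _) hnn
    have hbound : ∀ π ∈ An, expect (fun _ => starWt q) (fun ρ => ind (Ev π ρ)) ≤
        α ^ s * expect (fun _ => starWt q) (fun ρ => ind (A ρ ∧ Sa ρ)) * (β / α) ^ N π := by
      intro π hπ
      by_cases hsub : ∀ v, π v ≠ none → τ v ≠ none ∧ σ v = none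
      swap
      · have h2 : ∀ ρ, ind (Ev π ρ) = 0 := by
          intro ρ
          refine ind_not fun h => hsub fun v hv => ?_
          have h3 := (h.2.2.1 v).1 hv
          simp only [comb, Option.or_eq_none_iff] at h3
          exact ⟨h3.1, h3.2.1⟩
        simp only [h2]
        have h3 : expect (fun _ : V => starWt q) (fun _ => 0) = 0 := by simp [expect]
        rw [h3]
        exact mul_nonneg (mul_nonneg (pow_nonneg hα.le _) (expect_nonneg hw fun ρ => ind_nonneg _))
          (pow_nonneg (div_nonneg hβ hα.le) _)
      -- Fixing the free variables of the term so as to satisfy it lands in `Sa` at the cost of `β ^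
      -- N π`. Since `comb σ π` takes precedence over the restriction, the depth condition does not
      -- see the values just fixed; this is why the statement carries a `σ`.
      have hfix := expect_starWt_le_of_fix h0 h1 hβ hq (Finset.univ.filter fun v => π v ≠ none) τ
        (fun v hv => (hsub v (Finset.mem_filter.1 hv).2).1) (E := Ev π)
        (E' := fun ρ => (A ρ ∧ Sa ρ) ∧
          DTDepthGE (s - N π) fun x => Dnf F (fill (comb (comb σ π) ρ) x))
        (by
          intro ρ hρ v hv
          have h3 := ((hρ.2.2.1 v).1 (Finset.mem_filter.1 hv).2).2
          simp only [comb, Option.or_eq_none_iff] at h3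
          exact h3.2)
        (by
          rintro ρ ⟨hAρ, hf, hst, hbad⟩
          refine ⟨⟨hA ρ _ ?_ hAρ, ?_⟩, ?_⟩
          · intro v b hvb
            have hv : π v = none := by
              by_contra hv
              have h3 := ((hst v).1 hv).2
              simp [comb, hvb] at h3
            simp [hv, hvb]
          · intro v b hvb
            by_cases hv : π v = none
            · have h3 : comb σ ρ v ≠ none := by
                intro h4
                exact (hst v).2 ⟨by simp [hvb], h4⟩ hv
              obtain ⟨c, hc⟩ := Option.ne_none_iff_exists'.1 h3
              have h5 : c = b := by
                by_contra hne
                refine hf ⟨v, b, hvb, ?_⟩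
                rw [hc, Bool.eq_not.2 hne]
              subst h5
              simpa [comb, hv] using hc
            · simp [comb, hv, (hsub v hv).2, hvb]
          · convert hbad using 4 with x
            funext v
            by_cases hv : π v = none
            · simp [comb, hv]
            · obtain ⟨c, hc⟩ := Option.ne_none_iff_exists'.1 hv
              simp [comb, hc, (hsub v hv).2])
      refine hfix.trans ?_
      have hih := ih (fun ρ => A ρ ∧ Sa ρ) hSa (comb σ π) (s - N π)
      refine (mul_le_mul_of_nonneg_left hih (pow_nonneg hβ _)).trans ?_
      have hX : 0 ≤ expect (fun _ : V => starWt q) (fun ρ => ind (A ρ ∧ Sa ρ)) :=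
        expect_nonneg hw fun ρ => ind_nonneg _
      -- Only an inequality, because `s - N π` is truncated at 0.
      have hpow : α ^ (s - N π) * α ^ N π ≤ α ^ s := by
        rw [← pow_add]
        exact pow_le_pow_of_le_one hα.le hα1 (by omega)
      have h4 : β ^ N π * α ^ (s - N π) ≤ α ^ s * (β / α) ^ N π := by
        rw [div_pow, ← mul_div_assoc, le_div_iff₀ (pow_pos hα _)]
        nlinarith [mul_le_mul_of_nonneg_left hpow (pow_nonneg hβ (N π))]
      calc β ^ N π * (α ^ (s - N π) * expect (fun _ => starWt q) (fun ρ => ind (A ρ ∧ Sa ρ)))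
          = (β ^ N π * α ^ (s - N π)) * expect (fun _ => starWt q) (fun ρ => ind (A ρ ∧ Sa ρ)) := by
            ring
        _ ≤ _ := mul_le_mul_of_nonneg_right h4 hX
        _ = _ := by ring
    have hX : 0 ≤ expect (fun _ : V => starWt q) (fun ρ => ind (A ρ ∧ Sa ρ)) :=
      expect_nonneg hw fun ρ => ind_nonneg _
    have hαs : 0 ≤ α ^ s := pow_nonneg hα.le s
    calc expect (fun _ => starWt q)
          (fun ρ => ind (A ρ ∧ DTDepthGE s fun x => Dnf (τ :: F) (fill (comb σ ρ) x)))
        ≤ expect (fun _ => starWt q) (fun ρ =>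
            ind ((A ρ ∧ Fa ρ) ∧ DTDepthGE s fun x => Dnf F (fill (comb σ ρ) x)) +
              ∑ π ∈ An, ind (Ev π ρ)) := expect_mono hw hsplit
      _ ≤ α ^ s * expect (fun _ => starWt q) (fun ρ => ind (A ρ ∧ Fa ρ)) +
            ∑ π ∈ An, α ^ s * expect (fun _ => starWt q) (fun ρ => ind (A ρ ∧ Sa ρ)) *
              (β / α) ^ N π := by
          rw [expect_add, expect_sum]
          exact add_le_add (ih _ hFa σ s) (Finset.sum_le_sum hbound)
      _ ≤ α ^ s * expect (fun _ => starWt q) (fun ρ => ind (A ρ ∧ Fa ρ)) +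
            α ^ s * expect (fun _ => starWt q) (fun ρ => ind (A ρ ∧ Sa ρ)) := by
          rw [← Finset.mul_sum]
          refine add_le_add_right ?_ _
          exact mul_le_of_le_one_right (mul_nonneg hαs hX)
            (sum_answers_le hU (div_nonneg hβ hα.le) hk)
      _ = α ^ s * expect (fun _ => starWt q) (fun ρ => ind (A ρ ∧ Fa ρ) + ind (A ρ ∧ Sa ρ)) := by
          rw [expect_add, mul_add]
      _ ≤ _ := by
          -- `Fa` and `Sa` exclude each other, so the two contributions add up to at most that of
          -- `A`.
          refine mul_le_mul_of_nonneg_left (expect_mono hw fun ρ => ?_) hαs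
          refine ind_and_add_ind_and_le ?_
          rintro ⟨⟨v, b, hv, hc⟩, hs⟩
          have := (hs v b hv).symm.trans hc
          cases b <;> simp at this

/-- The proportion of free variables in one round of random restrictions, for depth `k`. -/
noncomputable def starRate (k : ℕ) : ℝ := 1 / (16 * k + 1)

lemma starRate_pos (k : ℕ) : 0 < starRate k := by unfold starRate; positivity

lemma starRate_le_one (k : ℕ) : starRate k ≤ 1 := by
  unfold starRate
  rw [div_le_one (by positivity)]
  have : (0 : ℝ) ≤ k := k.cast_nonneg
  linarith

lemma switching {k : ℕ} (hk : 1 ≤ k) {f : (V → Bool) → Prop} (hf : IsDNF k f) :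
    expect (fun _ => starWt (starRate k)) (fun ρ => ind ¬HasDT k fun x => f (fill ρ x)) ≤
      (1 / 2) ^ k := by
  classical
  have hk' : (1 : ℝ) ≤ k := by exact_mod_cast hk
  let F : List (V → Option Bool) :=
    (Finset.univ.filter fun τ => WidthLE k τ ∧ ∀ s', Sat τ s' → f s').toList
  have hfF : ∀ x, f x ↔ Dnf F x := by
    intro x
    constructor
    · intro hx
      obtain ⟨τ, h1, h2, h3⟩ := hf x hx
      exact ⟨τ, by simpa [F, h1] using h3, h2⟩
    · rintro ⟨τ, hτ, hs⟩
      simp only [F, Finset.mem_toList, Finset.mem_filter] at hτ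
      exact hτ.2.2 x hs
  -- `β` is forced by `starRate k`, and with `α = 1 / 2` the condition on answers reads `(1 + 1 /
  -- (2k)) ^ k ≤ exp (1 / 2) ≤ 2`. The depth is `k + 1` because having no tree of depth `k` means
  -- needing at least `k + 1`.
  have key := switching_aux (V := V) (q := starRate k) (α := 1 / 2) (β := 1 / (8 * k)) (k := k)
    (starRate_pos k).le (starRate_le_one k) (by positivity) (by norm_num) (by norm_num)
    (by unfold starRate; field_simp; ring)
    (by
      have h1 : (1 : ℝ) + 2 * (1 / (8 * k) / (1 / 2)) ≤ Real.exp (1 / (2 * k)) := by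
        have := Real.add_one_le_exp (1 / (2 * k : ℝ))
        refine le_trans (le_of_eq ?_) this
        field_simp
        ring
      refine (pow_le_pow_left₀ (by positivity) h1 k).trans ?_
      rw [← Real.exp_nat_mul]
      have h2 : (k : ℝ) * (1 / (2 * k)) = 1 / 2 := by field_simp
      rw [h2]
      have h3 : Real.exp (1 / 2) ^ 2 = Real.exp 1 := by rw [← Real.exp_nat_mul]; norm_num
      nlinarith [Real.exp_one_lt_d9, Real.exp_pos (1 / 2 : ℝ)])
    F (by
      intro τ hτ
      simp only [F, Finset.mem_toList, Finset.mem_filter] at hτ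
      exact hτ.2.1) (fun _ => True) (by simp) (fun _ => none) (k + 1)
  have hw : ∀ (_ : V) o, 0 ≤ starWt (starRate k) o :=
    fun _ => starWt_nonneg (starRate_pos k).le (starRate_le_one k)
  refine le_trans (expect_mono hw fun ρ => ?_) (key.trans ?_)
  · refine ind_mono fun h => ⟨trivial, ?_⟩
    intro l hl
    by_contra hlt
    refine h ?_
    have h2 : (fun x => f (fill ρ x)) = fun x => Dnf F (fill (comb (fun _ => none) ρ) x) := by
      funext x
      exact propext (hfF _)
    rw [h2]
    exact hl.mono (by omega)
  · have : expect (fun _ : V => starWt (starRate k)) (fun _ => ind True) ≤ 1 :=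
      expect_le_one hw (fun _ => sum_starWt _) _ fun _ => ind_le_one _
    refine (mul_le_of_le_one_right (by positivity) this).trans ?_
    exact pow_le_pow_of_le_one (by norm_num) (by norm_num) (Nat.le_succ k)

/-! ### Functions that random restrictions simplify -/

/-- After `D` rounds of random restrictions, `f` is a decision tree of depth `k` with probability
at least `1 - N * 2⁻ᵏ`. -/
def Simplifies (k D : ℕ) (N : ℝ) (f : (V → Bool) → Prop) : Prop :=
  expect (fun _ => starWt (starRate k ^ D)) (fun ρ => ind ¬HasDT k fun x => f (fill ρ x)) ≤
    N * (1 / 2) ^ k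

lemma starWt_starRate_pow_nonneg (k D : ℕ) (o : Option Bool) : 0 ≤ starWt (starRate k ^ D) o :=
  starWt_nonneg (pow_nonneg (starRate_pos k).le _)
    (pow_le_one₀ (starRate_pos k).le (starRate_le_one k)) o

lemma HasDT.simplifies {k : ℕ} {f : (V → Bool) → Prop} (h : HasDT k f) (D : ℕ) :
    Simplifies k D 0 f := by
  unfold Simplifies
  have : ∀ ρ, ind (¬HasDT k fun x => f (fill ρ x)) = 0 :=
    fun ρ => ind_not (not_not.2 (h.restrict ρ))
  simp [this, expect]

lemma Simplifies.weaken {k D : ℕ} {N N' : ℝ} {f : (V → Bool) → Prop} (h : Simplifies k D N f)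
    (hN : N ≤ N') : Simplifies k D N' f :=
  le_trans h (mul_le_mul_of_nonneg_right hN (by positivity))

lemma Simplifies.mono {k D D' : ℕ} {N : ℝ} {f : (V → Bool) → Prop} (h : Simplifies k D N f)
    (hD : D ≤ D') : Simplifies k D' N f := by
  obtain ⟨j, rfl⟩ := Nat.exists_eq_add_of_le hD
  unfold Simplifies at h ⊢
  rw [pow_add, ← expect_starWt_comb]
  refine le_trans (expect_mono (fun _ => starWt_starRate_pow_nonneg k D) fun ρ => ?_) h
  rw [← expect_const (c := fun _ : V => starWt (starRate k ^ j)) (fun _ => sum_starWt _)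
    (ind ¬HasDT k fun x => f (fill ρ x))]
  refine expect_mono (fun _ => starWt_starRate_pow_nonneg k j) fun ρ' => ind_mono fun h1 h2 => ?_
  refine h1 ?_
  simp only [fill_comb]
  exact h2.restrict ρ'

lemma Simplifies.not {k D : ℕ} {N : ℝ} {f : (V → Bool) → Prop} (h : Simplifies k D N f) :
    Simplifies k D N fun x => ¬f x := by
  refine le_trans (expect_mono (fun _ => starWt_starRate_pow_nonneg k D) fun ρ => ?_) h
  exact ind_mono fun h1 h2 => h1 h2.not

/-- Unless one of the `f i` fails after `D` rounds, all are trees of depth `k`, hence DNFs of width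
`k`, and so is their disjunction. One more round switches it back to a tree, with additional failure
probability at most `2⁻ᵏ`. -/
lemma Simplifies.exists {ι : Type*} [Fintype ι] {k D : ℕ} (hk : 1 ≤ k) {N : ι → ℝ}
    {f : ι → (V → Bool) → Prop} (h : ∀ i, Simplifies k D (N i) (f i)) :
    Simplifies k (D + 1) (∑ i, N i + 1) fun x => ∃ i, f i x := by
  unfold Simplifies
  rw [pow_succ, ← expect_starWt_comb]
  have h1 : ∀ ρ : V → Option Bool, expect (fun _ => starWt (starRate k))
      (fun ρ' => ind ¬HasDT k fun x => ∃ i, f i (fill (comb ρ ρ') x)) ≤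
        ∑ i, ind (¬HasDT k fun x => f i (fill ρ x)) + (1 / 2) ^ k := by
    intro ρ
    by_cases hρ : ∀ i, HasDT k fun x => f i (fill ρ x)
    · have h2 := switching hk (IsDNF.exists fun i => (hρ i).isDNF)
      simp only [fill_comb]
      exact h2.trans (le_add_of_nonneg_left (Finset.sum_nonneg fun i _ => ind_nonneg _))
    · push Not at hρ
      obtain ⟨i, hi⟩ := hρ
      refine (expect_le_one (fun _ => starWt_nonneg (starRate_pos k).le (starRate_le_one k))
        (fun _ => sum_starWt _) _ fun _ => ind_le_one _).trans ?_
      refine le_trans (le_of_eq (ind_of hi).symm) ?_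
      exact (Finset.single_le_sum (f := fun i => ind (¬HasDT k fun x => f i (fill ρ x)))
        (fun i _ => ind_nonneg _) (Finset.mem_univ i)).trans (le_add_of_nonneg_right (by positivity))
  refine (expect_mono (fun _ => starWt_starRate_pow_nonneg k D) h1).trans ?_
  rw [expect_add, expect_sum, expect_const fun _ => sum_starWt _, add_mul, one_mul,
    Finset.sum_mul]
  exact add_le_add_left (Finset.sum_le_sum fun i _ => h i) _

lemma IsDNF.simplifies {k : ℕ} (hk : 1 ≤ k) {f : (V → Bool) → Prop} (h : IsDNF k f) :
    Simplifies k 1 1 f := by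
  unfold Simplifies
  rw [pow_one, one_mul]
  exact switching hk h

lemma Simplifies.imp {k D : ℕ} (hk : 1 ≤ k) {N N' : ℝ} {f g : (V → Bool) → Prop}
    (hf : Simplifies k D N f) (hg : Simplifies k D N' g) :
    Simplifies k (D + 1) (N + N' + 1) fun x => f x → g x := by
  have h := Simplifies.exists (ι := Bool) hk (N := fun b => if b then N else N')
    (f := fun b x => if b = true then ¬f x else g x) (D := D) (by
      rintro (_ | _)
      · simpa using hg
      · simpa using hf.not)
  have h2 : (fun x => f x → g x) = fun x => ∃ b : Bool, if b = true then ¬f x else g x := by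
    funext x
    simp only [Bool.exists_bool, Bool.false_eq_true, if_false, if_true]
    exact propext (by tauto)
  rw [h2]
  simpa using h

/-- The total influence of a function that random restrictions simplify is small. -/
lemma Simplifies.sum_sens_le {k D : ℕ} {N : ℝ} {f : (V → Bool) → Prop} (h : Simplifies k D N f) :
    expect (fun _ (_ : Bool) => (1 / 2 : ℝ)) (fun s => ∑ v, ind (Sens f v s)) ≤
      (k + Fintype.card V * (N * (1 / 2) ^ k)) / starRate k ^ D := by
  classical
  set q := starRate k ^ D with hq
  have hq0 : 0 < q := pow_pos (starRate_pos k) D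
  rw [le_div_iff₀ hq0]
  have hhalf : ∀ (_ : V) (_ : Bool), (0 : ℝ) ≤ 1 / 2 := fun _ _ => by norm_num
  have hhalf1 : ∀ _ : V, ∑ _ : Bool, (1 / 2 : ℝ) = 1 := fun _ => by simp
  -- Filling a random restriction with fair coins gives a uniform point, and whether `v` was free is
  -- independent of that point. So sensitivity at a free variable has exactly `q` times the
  -- probability of sensitivity.
  have hstep : ∀ v, expect (fun _ (_ : Bool) => (1 / 2 : ℝ)) (fun s => ind (Sens f v s)) * q =
      expect (fun _ => starWt q) (fun ρ => expect (fun _ (_ : Bool) => (1 / 2 : ℝ)) fun x =>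
        ind (ρ v = none) * ind (Sens f v (fill ρ x))) := by
    intro v
    have h1 : ∀ (ρ : V → Option Bool), (∏ u, starWt q (ρ u)) * ind (ρ v = none) =
        ∏ u, (if u = v → ρ u = none then starWt q (ρ u) else 0) := by
      intro ρ
      by_cases hv : ρ v = none
      · rw [ind_of hv, mul_one]
        refine Finset.prod_congr rfl fun u _ => ?_
        rw [if_pos]
        rintro rfl; exact hv
      · rw [ind_not hv, mul_zero]
        refine (Finset.prod_eq_zero (Finset.mem_univ v) ?_).symm
        simp [hv]
    have h2 : expect (fun _ => starWt q) (fun ρ => expect (fun _ (_ : Bool) => (1 / 2 : ℝ)) fun x =>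
        ind (ρ v = none) * ind (Sens f v (fill ρ x))) =
        expect (fun u o => if u = v → o = none then starWt q o else 0) (fun ρ =>
          expect (fun _ (_ : Bool) => (1 / 2 : ℝ)) fun x => ind (Sens f v (fill ρ x))) := by
      refine Finset.sum_congr rfl fun ρ _ => ?_
      beta_reduce
      rw [expect_const_mul, ← mul_assoc, h1]
    rw [h2, expect_expect]
    refine Eq.trans ?_ (expect_map _ (fun z : Option Bool × Bool => z.1.getD z.2)
      fun s => ind (Sens f v s)).symm
    unfold expect
    rw [Finset.sum_mul]
    refine Finset.sum_congr rfl fun s _ => ?_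
    rw [mul_right_comm]
    congr 1
    have h3 : ∀ u, (∑ z : Option Bool × Bool, if z.1.getD z.2 = s u then
        (if u = v → z.1 = none then starWt q z.1 else 0) * (1 / 2) else 0) =
        1 / 2 * if u = v then q else 1 := by
      intro u
      rw [Fintype.sum_prod_type]
      by_cases hu : u = v <;> cases s u <;> simp [hu, Fintype.sum_option, starWt] <;> ring
    simp only [h3]
    rw [Finset.prod_mul_distrib, Finset.prod_ite_eq' Finset.univ v fun _ => q]
    simp
  -- At most `k` free variables are sensitive if the restricted function has a tree of depth `k`;
  -- otherwise all variables are counted.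
  have hpt : ∀ (ρ : V → Option Bool) (x : V → Bool),
      ∑ v, ind (ρ v = none) * ind (Sens f v (fill ρ x)) ≤
        k + Fintype.card V * ind (¬HasDT k fun x => f (fill ρ x)) := by
    intro ρ x
    by_cases hρ : HasDT k fun x => f (fill ρ x)
    · rw [ind_not (not_not.2 hρ), mul_zero, add_zero]
      refine le_trans (Finset.sum_le_sum fun v _ => ?_) (hρ.sum_sens_le x)
      by_cases hv : ρ v = none
      · rw [ind_of hv, one_mul]
        refine ind_mono fun hs => ?_
        unfold Sens at hs ⊢
        beta_reduce
        rwa [fill_update_of_none hv, ← fill_of_none hv x]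
      · rw [ind_not hv, zero_mul]
        exact ind_nonneg _
    · rw [ind_of hρ, mul_one]
      refine le_trans (Finset.sum_le_sum (g := fun _ => 1) fun v _ => ?_) ?_
      · exact mul_le_one₀ (ind_le_one _) (ind_nonneg _) (ind_le_one _)
      · simp
  rw [expect_sum, Finset.sum_mul, Finset.sum_congr rfl fun v _ => hstep v, ← expect_sum]
  have hle : ∀ ρ : V → Option Bool, ∑ v, expect (fun _ (_ : Bool) => (1 / 2 : ℝ)) (fun x =>
      ind (ρ v = none) * ind (Sens f v (fill ρ x))) ≤
        k + Fintype.card V * ind (¬HasDT k fun x => f (fill ρ x)) := by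
    intro ρ
    rw [← expect_sum, ← expect_const hhalf1 (k + Fintype.card V * ind _)]
    exact expect_mono hhalf (hpt ρ)
  refine (expect_mono (fun _ => starWt_starRate_pow_nonneg k D) hle).trans ?_
  rw [expect_add, expect_const fun _ => sum_starWt _, expect_const_mul]
  exact add_le_add_right (mul_le_mul_of_nonneg_left h (Nat.cast_nonneg _)) _

end Switching

/-! ### First-order sentences in random induced substructures -/

/-- There is an `r`-path from `a` to `b` all of whose vertices but `a` lie in a set of at most `w`
elements, each satisfying `s`. -/
def Short {V : Type*} (w : ℕ) (r : V → V → Prop) (s : V → Bool) (a b : V) : Prop :=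
  ∃ I : Finset V, I.card ≤ w ∧ (∀ v ∈ I, s v = true) ∧
    Relation.TransGen (fun u v => r u v ∧ v ∈ I) a b

/-- The structure in which `<*` only takes into account paths with at most `w` steps. -/
@[reducible]
def truncModel {n : ℕ} (w : ℕ) (r : Fin n → Fin n → Prop) : vocabulary.Structure (Fin n) where
  funMap f := nomatch f
  RelMap
    | Rel.lt => fun v => v 0 < v 1
    | Rel.ltStar => fun v => Short w r (fun _ => true) (v 0) (v 1)

/-- The index of the variable which a term in a relational vocabulary consists of. -/
def varIdx {n : ℕ} : vocabulary.Term (Empty ⊕ Fin n) → Fin n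
  | .var (Sum.inr i) => i
  | .var (Sum.inl e) => e.elim
  | .func f _ => Empty.elim f

lemma realize_eq_varIdx {n k : ℕ} (S : vocabulary.Structure (Fin k))
    (t : vocabulary.Term (Empty ⊕ Fin n)) (v : Empty → Fin k) (xs : Fin n → Fin k) :
    t.realize (Sum.elim v xs) = xs (varIdx t) := by
  rcases t with (e | i) | ⟨f, _⟩
  · exact e.elim
  · rfl
  · exact Empty.elim f

/-- The interpretation of the relation symbols relativized to `s`. -/
def relVal {m : ℕ} (w : ℕ) (r : Fin m → Fin m → Prop) (s : Fin m → Bool) :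
    ∀ {l : ℕ}, Rel l → (Fin l → Fin m) → Prop
  | _, Rel.lt, v => v 0 < v 1
  | _, Rel.ltStar, v => Short w r s (v 0) (v 1)

/-- The truth value of a formula relativized to the elements satisfying `s`. -/
def relRealize {m : ℕ} (w : ℕ) (r : Fin m → Fin m → Prop) :
    ∀ {n : ℕ}, vocabulary.BoundedFormula Empty n → (Fin n → Fin m) → (Fin m → Bool) → Prop
  | _, .falsum, _, _ => False
  | _, .equal t₁ t₂, xs, _ => xs (varIdx t₁) = xs (varIdx t₂)
  | _, .rel R ts, xs, s => relVal w r s R fun i => xs (varIdx (ts i))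
  | _, .imp φ ψ, xs, s => relRealize w r φ xs s → relRealize w r ψ xs s
  | _, .all φ, xs, s => ∀ y, s y = true → relRealize w r φ (Fin.snoc xs y) s

/-- A path starting in the range of `ι` whose later vertices satisfy `s` never leaves the range. -/
lemma short_comp_iff {k m w : ℕ} {r : Fin m → Fin m → Prop} {s : Fin m → Bool}
    {ι : Fin k → Fin m} (hι : Function.Injective ι) (hs : ∀ v, s v = true ↔ ∃ i, ι i = v)
    (a b : Fin k) :
    Short w r s (ι a) (ι b) ↔ Short w (fun u v => r (ι u) (ι v)) (fun _ => true) a b := by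
  classical
  constructor
  · rintro ⟨I, hI, hIs, hp⟩
    refine ⟨Finset.univ.filter fun i => ι i ∈ I, ?_, by simp, ?_⟩
    · rw [← Finset.card_image_of_injective _ hι]
      refine (Finset.card_le_card fun v hv => ?_).trans hI
      obtain ⟨i, hi, rfl⟩ := Finset.mem_image.1 hv
      exact (Finset.mem_filter.1 hi).2
    · have key : ∀ c, Relation.TransGen (fun u v => r u v ∧ v ∈ I) (ι a) c →
          ∃ c', ι c' = c ∧ Relation.TransGen (fun u v => r (ι u) (ι v) ∧
            v ∈ Finset.univ.filter fun i => ι i ∈ I) a c' := by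
        intro c hc
        induction hc with
        | single h =>
          obtain ⟨i, rfl⟩ := (hs _).1 (hIs _ h.2)
          exact ⟨i, rfl, .single ⟨h.1, by simpa using h.2⟩⟩
        | tail _ h ih =>
          obtain ⟨c', rfl, hc'⟩ := ih
          obtain ⟨i, rfl⟩ := (hs _).1 (hIs _ h.2)
          exact ⟨i, rfl, hc'.tail ⟨h.1, by simpa using h.2⟩⟩
      obtain ⟨c', hc', h⟩ := key _ hp
      rwa [hι hc'] at h
  · rintro ⟨I, hI, -, hp⟩
    refine ⟨I.image ι, Finset.card_image_le.trans hI, ?_, ?_⟩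
    · intro v hv
      obtain ⟨i, _, rfl⟩ := Finset.mem_image.1 hv
      exact (hs _).2 ⟨i, rfl⟩
    · exact hp.lift ι fun u v h => ⟨h.1, Finset.mem_image_of_mem _ h.2⟩

/-- Flipping one bit of `s` thus means adding a vertex to the structure or deleting one from it. -/
lemma relRealize_iff {k m w : ℕ} {r : Fin m → Fin m → Prop} {s : Fin m → Bool}
    {ι : Fin k → Fin m} (hι : StrictMono ι) (hs : ∀ v, s v = true ↔ ∃ i, ι i = v)
    {n : ℕ} (φ : vocabulary.BoundedFormula Empty n) (v : Empty → Fin k) (xs : Fin n → Fin k) :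
    relRealize w r φ (fun i => ι (xs i)) s ↔
      @BoundedFormula.Realize vocabulary (Fin k) (truncModel w fun u v => r (ι u) (ι v)) Empty n
        φ v xs := by
  let inst := truncModel w fun u v => r (ι u) (ι v)
  induction φ with
  | falsum => exact Iff.rfl
  | equal t₁ t₂ =>
    simp only [relRealize, BoundedFormula.Realize, realize_eq_varIdx]
    exact hι.injective.eq_iff
  | rel R ts =>
    simp only [relRealize, BoundedFormula.Realize, realize_eq_varIdx]
    cases R with
    | lt => exact hι.lt_iff_lt
    | ltStar => exact short_comp_iff hι.injective hs _ _
  | imp φ ψ ih₁ ih₂ =>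
    simp only [relRealize, BoundedFormula.Realize]
    exact imp_congr (ih₁ xs) (ih₂ xs)
  | all φ ih =>
    simp only [relRealize, BoundedFormula.Realize]
    have h : ∀ y, (Fin.snoc (fun i => ι (xs i)) (ι y) : Fin _ → Fin m) =
        fun i => ι ((Fin.snoc xs y : Fin _ → Fin k) i) := by
      intro y
      funext i
      refine Fin.lastCases ?_ (fun j => ?_) i <;> simp
    constructor
    · intro H y
      refine (ih (Fin.snoc xs y)).1 ?_
      rw [← h]
      exact H (ι y) ((hs _).2 ⟨y, rfl⟩)
    · intro H y hy
      obtain ⟨i, rfl⟩ := (hs y).1 hy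
      rw [h]
      exact (ih _).2 (H i)

/-- Each witnessing set `I` supplies the term saying that all its elements are present. This is
where truncating paths is needed. -/
lemma Short.isDNF {m w : ℕ} (r : Fin m → Fin m → Prop) (a b : Fin m) :
    IsDNF w fun s => Short w r s a b := by
  classical
  rintro s ⟨I, hI, hs, hp⟩
  refine ⟨fun v => if v ∈ I then some true else none, ⟨I, hI, by simp⟩, ?_, ?_⟩
  · intro v c hv
    by_cases hvI : v ∈ I
    · simp only [hvI, if_true, Option.some_inj] at hv
      rw [hs v hvI, hv]
    · simp [hvI] at hv
  · intro s' hs'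
    exact ⟨I, hI, fun v hv => hs' v true (by simp [hv]), hp⟩

/-- Each connective or quantifier costs a bounded number of rounds, and a quantifier adds up `m`
failure probabilities. Hence `D` and the polynomial bound depend on `φ` only, uniformly in the edges
`r`. -/
theorem simplifies_relRealize {n : ℕ} (φ : vocabulary.BoundedFormula Empty n) :
    ∃ D R : ℕ, ∀ (m w k : ℕ) (r : Fin m → Fin m → Prop) (xs : Fin n → Fin m), 1 ≤ k → w ≤ k →
      Simplifies k D (R * ((m : ℝ) + 1) ^ R) (relRealize w r φ xs) := by
  induction φ with
  | falsum =>
    refine ⟨0, 0, fun m w k r xs hk hw => ?_⟩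
    exact ((HasDT.const k False).simplifies 0).weaken (by simp)
  | equal t₁ t₂ =>
    refine ⟨0, 0, fun m w k r xs hk hw => ?_⟩
    exact ((HasDT.const k (xs (varIdx t₁) = xs (varIdx t₂))).simplifies 0).weaken (by simp)
  | rel R ts =>
    refine ⟨1, 1, fun m w k r xs hk hw => ?_⟩
    have hm : (1 : ℝ) ≤ (1 : ℕ) * ((m : ℝ) + 1) ^ 1 := by simp
    cases R with
    | lt =>
      exact ((HasDT.const k (xs (varIdx (ts 0)) < xs (varIdx (ts 1)))).simplifies 1).weaken
        (zero_le_one.trans hm)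
    | ltStar =>
      exact (((Short.isDNF r (xs (varIdx (ts 0))) (xs (varIdx (ts 1)))).mono hw).simplifies
        hk).weaken hm
  | imp φ ψ ih₁ ih₂ =>
    obtain ⟨D₁, R₁, h₁⟩ := ih₁
    obtain ⟨D₂, R₂, h₂⟩ := ih₂
    refine ⟨max D₁ D₂ + 1, R₁ + R₂ + 1, fun m w k r xs hk hw => ?_⟩
    have h := ((h₁ m w k r xs hk hw).mono (le_max_left D₁ D₂)).imp hk
      ((h₂ m w k r xs hk hw).mono (le_max_right D₁ D₂))
    refine h.weaken ?_
    have hm : (1 : ℝ) ≤ (m : ℝ) + 1 := by simp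
    have e₁ : ((m : ℝ) + 1) ^ R₁ ≤ ((m : ℝ) + 1) ^ (R₁ + R₂ + 1) :=
      pow_le_pow_right₀ hm (by omega)
    have e₂ : ((m : ℝ) + 1) ^ R₂ ≤ ((m : ℝ) + 1) ^ (R₁ + R₂ + 1) :=
      pow_le_pow_right₀ hm (by omega)
    have e₃ : (1 : ℝ) ≤ ((m : ℝ) + 1) ^ (R₁ + R₂ + 1) := one_le_pow₀ hm
    push_cast
    nlinarith [mul_le_mul_of_nonneg_left e₁ (Nat.cast_nonneg (α := ℝ) R₁),
      mul_le_mul_of_nonneg_left e₂ (Nat.cast_nonneg (α := ℝ) R₂)]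
  | all φ ih =>
    obtain ⟨D, R, h⟩ := ih
    refine ⟨D + 1 + 1, R + 1, fun m w k r xs hk hw => ?_⟩
    have h1 : ∀ y, Simplifies k (D + 1) (0 + R * ((m : ℝ) + 1) ^ R + 1)
        fun s => ¬(s y = true → relRealize w r φ (Fin.snoc xs y) s) := fun y =>
      ((((HasDT.literal y).mono hk).simplifies D).imp hk (h m w k r (Fin.snoc xs y) hk hw)).not
    have h2 := (Simplifies.exists hk h1).not
    have h3 : (fun s => ¬∃ y, ¬(s y = true → relRealize w r φ (Fin.snoc xs y) s)) =
        relRealize w r φ.all xs := by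
      funext s
      simp only [relRealize]
      exact propext (by push Not; rfl)
    rw [h3] at h2
    refine h2.weaken ?_
    have hm : (1 : ℝ) ≤ (m : ℝ) + 1 := by simp
    have e : (1 : ℝ) ≤ ((m : ℝ) + 1) ^ R := one_le_pow₀ hm
    have e0 : (0 : ℝ) ≤ (R : ℝ) := R.cast_nonneg
    have e1 : (0 : ℝ) ≤ (m : ℝ) := m.cast_nonneg
    simp only [Finset.sum_const, Finset.card_univ, Fintype.card_fin, nsmul_eq_mul]
    push_cast
    rw [pow_succ]
    nlinarith [mul_nonneg e0 (zero_le_one.trans e), mul_nonneg e1 (zero_le_one.trans e),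
      mul_le_mul_of_nonneg_left e e1]

/-! ### Random relations -/

/-- The weights of a coin that shows `true` with probability `p`. -/
def bern (p : ℝ) : Bool → ℝ
  | true => p
  | false => 1 - p

lemma sum_bern (p : ℝ) : ∑ b, bern p b = 1 := by simp [bern]

lemma bern_nonneg {p : ℝ} (h0 : 0 ≤ p) (h1 : p ≤ 1) (b : Bool) : 0 ≤ bern p b := by
  cases b <;> simp only [bern] <;> linarith

/-- The directed edges given by an array of bits. -/
def edgeRel {n : ℕ} (x : Fin n × Fin n → Bool) (u v : Fin n) : Prop := u < v ∧ x (u, v) = true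

/-- The probability that `φ` holds when `<*` only takes into account paths with at most `w` steps. -/
noncomputable def truncProb (w : ℕ) (p : ℝ) (n : ℕ) (φ : vocabulary.Sentence) : ℝ :=
  expect (fun _ => bern p) fun x : Fin n × Fin n → Bool =>
    ind (@Sentence.Realize vocabulary (Fin n) (truncModel w (edgeRel x)) φ)

/-- The increasing enumeration of `S` identifies the induced structure with one on `Fin k`, whose
bits are again independent coins; so only the size of `S` matters. -/
lemma expect_relRealize {m k w : ℕ} {p : ℝ} (φ : vocabulary.Sentence) (S : Finset (Fin m))
    (hS : S.card = k) {s : Fin m → Bool} (hs : ∀ v, s v = true ↔ v ∈ S) :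
    expect (fun _ => bern p) (fun x : Fin m × Fin m → Bool =>
      ind (relRealize w (edgeRel x) φ Fin.elim0 s)) = truncProb w p k φ := by
  let ι := S.orderEmbOfFin hS
  have hι : StrictMono ι := ι.strictMono
  have hs' : ∀ v, s v = true ↔ ∃ i, ι i = v := by
    intro v
    have : v ∈ Set.range ι ↔ v ∈ S := by rw [Finset.range_orderEmbOfFin]; simp
    rw [hs, ← this]; rfl
  unfold truncProb
  rw [← expect_comp_injective (c := fun _ => bern p) (fun _ => sum_bern p)
    (ι := fun e : Fin k × Fin k => (ι e.1, ι e.2))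
    (fun a b hab => Prod.ext (hι.injective (congrArg Prod.fst hab))
      (hι.injective (congrArg Prod.snd hab)))]
  congr 1
  funext x
  congr 1
  have h := relRealize_iff (w := w) (r := edgeRel x) hι hs' φ default Fin.elim0
  have h1 : (fun i => ι ((Fin.elim0 : Fin 0 → Fin k) i)) = Fin.elim0 := by
    funext i; exact i.elim0
  have h2 : (fun u v => edgeRel x (ι u) (ι v)) =
      edgeRel fun e : Fin k × Fin k => x (ι e.1, ι e.2) := by
    funext u v
    simp [edgeRel, hι.lt_iff_lt]
  rw [h1, h2] at h
  rw [h]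
  unfold Sentence.Realize Formula.Realize
  congr! 1

/-! ### Influence of a vertex on the middle layer of the cube. -/

lemma abs_ind_sub_le (P Q : Prop) : |ind P - ind Q| ≤ ind ¬(Q ↔ P) := by
  by_cases hP : P <;> by_cases hQ : Q <;> simp [ind, hP, hQ]

/-- Both probabilities are computed from the same edges, one on `S` and the other on `S` without
`v`. -/
lemma abs_truncProb_succ_sub_le_expect {m n w : ℕ} {p : ℝ} (h0 : 0 ≤ p) (h1 : p ≤ 1)
    (φ : vocabulary.Sentence) (S : Finset (Fin m)) (hS : S.card = n + 1) {s : Fin m → Bool}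
    (hs : ∀ v, s v = true ↔ v ∈ S) {v : Fin m} (hv : v ∈ S) :
    |truncProb w p (n + 1) φ - truncProb w p n φ| ≤
      expect (fun _ => bern p) fun x : Fin m × Fin m → Bool =>
        ind (Sens (relRealize w (edgeRel x) φ Fin.elim0) v s) := by
  rw [← expect_relRealize φ S hS hs, ← expect_relRealize φ (S.erase v)
    (by rw [Finset.card_erase_of_mem hv, hS]; rfl) (s := Function.update s v (!s v)), ← expect_sub]
  · refine (abs_expect_le (fun _ => bern_nonneg h0 h1) _).trans ?_
    exact expect_mono (fun _ => bern_nonneg h0 h1) fun x => abs_ind_sub_le _ _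
  · intro u
    by_cases hu : u = v
    · subst hu; simp [(hs u).2 hv]
    · simp [hu, hs]

/-- After squaring, the induction step amounts to `4n(n + 1) ≤ (2n + 1)²`. -/
lemma four_pow_le_sqrt_mul_centralBinom {n : ℕ} (hn : 1 ≤ n) :
    (4 : ℝ) ^ n ≤ 2 * √n * n.centralBinom := by
  have key : ∀ n : ℕ, 1 ≤ n → (16 : ℝ) ^ n ≤ 4 * n * (n.centralBinom : ℝ) ^ 2 := by
    intro n hn
    induction n, hn using Nat.le_induction with
    | base => simp [Nat.centralBinom]; norm_num [Nat.choose]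
    | succ n hn ih =>
      have h : ((n : ℝ) + 1) * ((n + 1).centralBinom : ℝ) = 2 * (2 * n + 1) * n.centralBinom := by
        exact_mod_cast Nat.succ_mul_centralBinom_succ n
      have hn' : (0 : ℝ) < (n : ℝ) + 1 := by positivity
      have h2 : ((n + 1).centralBinom : ℝ) = 2 * (2 * n + 1) * n.centralBinom / (n + 1) := by
        rw [eq_div_iff hn'.ne', mul_comm, h]
      push_cast
      rw [h2, pow_succ, div_pow, ← mul_div_assoc, le_div_iff₀ (by positivity)]
      have h3 : 0 ≤ (n.centralBinom : ℝ) ^ 2 := by positivity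
      nlinarith [mul_le_mul_of_nonneg_right ih (by positivity : (0 : ℝ) ≤ 16 * (n + 1) ^ 2),
        mul_nonneg hn'.le h3]
  have h := Real.sqrt_le_sqrt (key n hn)
  have h1 : √((16 : ℝ) ^ n) = 4 ^ n := by
    rw [show (16 : ℝ) ^ n = (4 ^ n) ^ 2 by rw [← pow_mul, mul_comm, pow_mul]; norm_num]
    exact Real.sqrt_sq (by positivity)
  rw [h1, Real.sqrt_mul (by positivity), Real.sqrt_sq (by positivity),
    Real.sqrt_mul (by norm_num), show √(4 : ℝ) = 2 by
      rw [show (4 : ℝ) = 2 ^ 2 by norm_num]; exact Real.sqrt_sq (by norm_num)] at h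
  exact h

/-- Deleting a vertex has little influence on the truth of a first-order sentence. -/
theorem exists_abs_truncProb_succ_sub_le (φ : vocabulary.Sentence) :
    ∃ D R : ℕ, ∀ (n w k : ℕ) (p : ℝ), 0 ≤ p → p ≤ 1 → 1 ≤ k → w ≤ k →
      |truncProb w p (n + 1) φ - truncProb w p n φ| ≤
        2 * (k + (2 * n + 3) * (R * (2 * n + 3 : ℝ) ^ R * (1 / 2) ^ k)) * (16 * k + 1) ^ D /
          √((n : ℝ) + 1) := by
  classical
  obtain ⟨D, R, h⟩ := simplifies_relRealize φ
  refine ⟨D, R, fun n w k p h0 h1 hk hw => ?_⟩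
  set m := 2 * (n + 1) with hm
  set Δ := |truncProb w p (n + 1) φ - truncProb w p n φ| with hΔ
  set X := ((k : ℝ) + (2 * n + 3) * (R * (2 * n + 3 : ℝ) ^ R * (1 / 2) ^ k)) * (16 * k + 1) ^ D
    with hX
  let f : (Fin m × Fin m → Bool) → (Fin m → Bool) → Prop :=
    fun x => relRealize w (edgeRel x) φ Fin.elim0
  have hbern : ∀ (_ : Fin m × Fin m) b, 0 ≤ bern p b := fun _ => bern_nonneg h0 h1
  have hinf : ∀ x, ∑ s : Fin m → Bool, ∑ v, ind (Sens (f x) v s) ≤ 2 ^ m * X := by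
    intro x
    have h2 := (h m w k (edgeRel x) Fin.elim0 hk hw).sum_sens_le
    unfold expect at h2
    simp only [Finset.prod_const, Finset.card_univ, Fintype.card_fin] at h2
    rw [← Finset.mul_sum] at h2
    have h3 : (2 : ℝ) ^ m * (1 / 2) ^ m = 1 := by rw [← mul_pow]; norm_num
    calc ∑ s : Fin m → Bool, ∑ v, ind (Sens (f x) v s)
        = 2 ^ m * ((1 / 2) ^ m * ∑ s : Fin m → Bool, ∑ v, ind (Sens (f x) v s)) := by
          rw [← mul_assoc, h3, one_mul]
      _ ≤ 2 ^ m * X := by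
          refine mul_le_mul_of_nonneg_left (h2.trans ?_) (by positivity)
          have h4 : (m : ℝ) + 1 = 2 * n + 3 := by rw [hm]; push_cast; ring
          rw [h4, hX]
          unfold starRate
          have h6 : (1 / (16 * (k : ℝ) + 1)) ^ D = ((16 * (k : ℝ) + 1) ^ D)⁻¹ := by
            rw [one_div, inv_pow]
          rw [h6, div_inv_eq_mul]
          have h5 : (m : ℝ) ≤ 2 * n + 3 := by linarith
          gcongr
  -- Pairs of a set `S` of size `n + 1` and `v ∈ S` each contribute at least `Δ` on average over the
  -- edges, and they are only some of the pairs in the total influence bounded by `hinf`.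
  have hsum : ((m.choose (n + 1) : ℕ) : ℝ) * ((n + 1) * Δ) ≤ 2 ^ m * X := by
    have hle : ∀ S ∈ Finset.powersetCard (n + 1) (Finset.univ : Finset (Fin m)),
        ((n : ℝ) + 1) * Δ ≤ expect (fun _ => bern p) fun x : Fin m × Fin m → Bool =>
          ∑ v, ind (Sens (f x) v fun u => decide (u ∈ S)) := by
      intro S hS
      have hS := (Finset.mem_powersetCard.1 hS).2
      rw [expect_sum]
      have h2 : ∑ v ∈ S, Δ = (n + 1) * Δ := by
        rw [Finset.sum_const, hS, nsmul_eq_mul]; push_cast; ring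
      rw [← h2]
      refine (Finset.sum_le_sum fun v hv => abs_truncProb_succ_sub_le_expect h0 h1 φ S hS
        (s := fun u => decide (u ∈ S)) (by simp) hv).trans ?_
      exact Finset.sum_le_sum_of_subset_of_nonneg (Finset.subset_univ S) fun v _ _ =>
        expect_nonneg hbern fun x => ind_nonneg _
    have hcard : ((m.choose (n + 1) : ℕ) : ℝ) * ((n + 1) * Δ) =
        ∑ S ∈ Finset.powersetCard (n + 1) (Finset.univ : Finset (Fin m)), (n + 1) * Δ := by
      rw [Finset.sum_const, Finset.card_powersetCard, nsmul_eq_mul, Finset.card_univ,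
        Fintype.card_fin]
    rw [hcard]
    refine (Finset.sum_le_sum hle).trans ?_
    rw [← expect_sum, ← expect_const (c := fun _ : Fin m × Fin m => bern p) (fun _ => sum_bern p)
      (2 ^ m * X)]
    refine expect_mono hbern fun x => le_trans ?_ (hinf x)
    rw [← Finset.sum_image (f := fun s : Fin m → Bool => ∑ v, ind (Sens (f x) v s))
      (g := fun (S : Finset (Fin m)) u => decide (u ∈ S))]
    · exact Finset.sum_le_sum_of_subset_of_nonneg (Finset.subset_univ _) fun s _ _ =>
        Finset.sum_nonneg fun v _ => ind_nonneg _
    · intro S _ S' _ hSS'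
      ext u
      simpa using congrFun hSS' u
  -- Since `m = 2 * (n + 1)`, the middle layer costs a factor of order `√(n + 1)`, against the `n +
  -- 1` gained from the choice of `v`.
  have hcb := four_pow_le_sqrt_mul_centralBinom (n := n + 1) (by omega)
  rw [Nat.centralBinom] at hcb
  have h4 : (2 : ℝ) ^ m = 4 ^ (n + 1) := by rw [hm, pow_mul]; norm_num
  have hc : (0 : ℝ) < (m.choose (n + 1) : ℕ) := by
    exact_mod_cast Nat.choose_pos (by omega)
  push_cast at hcb
  have hX0 : 0 ≤ X := by rw [hX]; positivity
  have hsq : √((n : ℝ) + 1) * √((n : ℝ) + 1) = n + 1 := Real.mul_self_sqrt (by positivity)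
  have hpos : 0 < √((n : ℝ) + 1) := Real.sqrt_pos.2 (by positivity)
  have h5 : ((m.choose (n + 1) : ℕ) : ℝ) * ((n + 1) * Δ) ≤
      (m.choose (n + 1) : ℕ) * (2 * √((n : ℝ) + 1) * X) := by
    refine hsum.trans ?_
    rw [h4]
    calc (4 : ℝ) ^ (n + 1) * X ≤ (2 * √((n : ℝ) + 1) * (m.choose (n + 1) : ℕ)) * X :=
          mul_le_mul_of_nonneg_right hcb hX0
      _ = _ := by ring
  have h6 := le_of_mul_le_mul_left h5 hc
  rw [le_div_iff₀ hpos, mul_assoc 2, ← hX]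
  refine le_of_mul_le_mul_right ?_ hpos
  calc Δ * √((n : ℝ) + 1) * √((n : ℝ) + 1) = (n + 1) * Δ := by rw [mul_assoc, hsq]; ring
    _ ≤ _ := h6
    _ = _ := by ring

/-! ### The random model as a function of independent bits -/

/-- The graph on `Fin n` whose adjacency is read off an array of bits. -/
def graphOf {n : ℕ} (x : Fin n × Fin n → Bool) : SimpleGraph (Fin n) where
  Adj u v := edgeRel x u v ∨ edgeRel x v u
  symm := ⟨fun _ _ h => h.symm⟩
  loopless := ⟨fun u h => by rcases h with h | h <;> exact lt_irrefl _ h.1⟩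

lemma graphOf_eq_iff {n : ℕ} (x : Fin n × Fin n → Bool) (G : SimpleGraph (Fin n))
    [DecidableRel G.Adj] :
    graphOf x = G ↔ ∀ e ∈ Finset.univ.filter (fun e : Fin n × Fin n => e.1 < e.2),
      x e = decide (G.Adj e.1 e.2) := by
  constructor
  · rintro rfl ⟨u, v⟩ he
    have huv : u < v := (Finset.mem_filter.1 he).2
    rw [Bool.eq_iff_iff, decide_eq_true_iff]
    simp [graphOf, edgeRel, huv, huv.not_gt]
  · intro h
    have key : ∀ u v, u < v → ((graphOf x).Adj u v ↔ G.Adj u v) := by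
      intro u v huv
      have h1 := h (u, v) (by simpa using huv)
      rw [Bool.eq_iff_iff, decide_eq_true_iff] at h1
      rw [← h1]
      simp [graphOf, edgeRel, huv, huv.not_gt]
    ext u v
    rcases lt_trichotomy u v with huv | rfl | huv
    · exact key u v huv
    · simp
    · rw [SimpleGraph.adj_comm, key v u huv, SimpleGraph.adj_comm]

lemma card_filter_lt_and_adj {n : ℕ} (G : SimpleGraph (Fin n)) [DecidableRel G.Adj] :
    (Finset.univ.filter fun e : Fin n × Fin n => e.1 < e.2 ∧ G.Adj e.1 e.2).card =
      G.edgeSet.ncard := by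
  rw [← SimpleGraph.coe_edgeFinset, Set.ncard_coe_finset]
  refine Finset.card_bij (fun e _ => s(e.1, e.2)) ?_ ?_ ?_
  · intro e he
    simpa using (Finset.mem_filter.1 he).2.2
  · rintro ⟨a, b⟩ h1 ⟨c, d⟩ h2 heq
    have h1 : a < b := (Finset.mem_filter.1 h1).2.1
    have h2 : c < d := (Finset.mem_filter.1 h2).2.1
    rcases Sym2.eq_iff.1 heq with ⟨h3, h4⟩ | ⟨h3, h4⟩
    · exact Prod.ext h3 h4
    · dsimp only at h3 h4
      subst h3 h4
      exact absurd h1 h2.not_gt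
  · intro e he
    induction e with
    | _ u v =>
      have he : G.Adj u v := by simpa using he
      rcases lt_or_gt_of_ne he.ne with huv | huv
      · exact ⟨(u, v), by simpa using ⟨huv, he⟩, rfl⟩
      · exact ⟨(v, u), by simpa using ⟨huv, he.symm⟩, Sym2.eq_swap⟩

/-- Only the bits at pairs `u < v` matter; the others sum out to 1. -/
lemma expect_graphOf_eq {n : ℕ} (p : unitInterval) (G : SimpleGraph (Fin n)) :
    expect (fun _ => bern p) (fun x => ind (graphOf x = G)) =
      (SimpleGraph.binomialRandom (Fin n) p).real {G} := by
  classical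
  have hT : (Finset.univ.filter fun e : Fin n × Fin n => e.1 < e.2).card = n.choose 2 := by
    have h := card_filter_lt_and_adj (⊤ : SimpleGraph (Fin n))
    rw [← SimpleGraph.coe_edgeFinset, Set.ncard_coe_finset,
      SimpleGraph.card_edgeFinset_top_eq_card_choose_two, Fintype.card_fin] at h
    rw [← h]
    congr 1
    ext e
    simp only [Finset.mem_filter, Finset.mem_univ, true_and, SimpleGraph.top_adj]
    exact ⟨fun h => ⟨h, h.ne⟩, And.left⟩
  simp only [graphOf_eq_iff]
  rw [expect_forall_mem fun _ => sum_bern _]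
  rw [MeasureTheory.measureReal_def, SimpleGraph.binomialRandom_singleton,
    ← card_filter_lt_and_adj, Nat.card_fin, ← hT]
  have h1 : ∀ e : Fin n × Fin n, bern p (decide (G.Adj e.1 e.2)) =
      if G.Adj e.1 e.2 then (p : ℝ) else 1 - p := by
    intro e
    by_cases h : G.Adj e.1 e.2 <;> simp [h, bern]
  simp only [h1]
  rw [Finset.prod_ite, Finset.prod_const, Finset.prod_const, Finset.filter_filter]
  have h2 := Finset.card_filter_add_card_filter_not
    (s := Finset.univ.filter fun e : Fin n × Fin n => e.1 < e.2) fun e => G.Adj e.1 e.2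
  rw [Finset.filter_filter] at h2
  rw [← h2, Nat.add_sub_cancel_left]
  simp

lemma binomialRandom_real_eq_expect {n : ℕ} (p : unitInterval) (A : Set (SimpleGraph (Fin n))) :
    (SimpleGraph.binomialRandom (Fin n) p).real A =
      expect (fun _ => bern p) fun x => ind (graphOf x ∈ A) := by
  classical
  have h1 : ∀ x : Fin n × Fin n → Bool,
      ind (graphOf x ∈ A) = ∑ G ∈ A.toFinset, ind (graphOf x = G) := by
    intro x
    by_cases hx : graphOf x ∈ A
    · rw [Finset.sum_eq_single (graphOf x)]
      · simp [ind, hx]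
      · intro G _ hG
        exact ind_not (Ne.symm hG)
      · simp [hx]
    · rw [ind_not hx]
      refine (Finset.sum_eq_zero fun G hG => ind_not ?_).symm
      rintro rfl
      exact hx (by simpa using hG)
  have : MeasurableSingletonClass (SimpleGraph (Fin n)) := ⟨fun G => by
    have h2 : ({G} : Set (SimpleGraph (Fin n))) = SimpleGraph.edgeSet ⁻¹' {G.edgeSet} := by
      ext G'
      simp
    rw [h2]
    exact SimpleGraph.measurable_edgeSet (MeasurableSet.singleton _)⟩
  simp only [h1]
  rw [expect_sum, Finset.sum_congr rfl fun G _ => expect_graphOf_eq p G,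
    MeasureTheory.sum_measureReal_singleton, Set.coe_toFinset]

lemma ltStar_graphOf {n : ℕ} (x : Fin n × Fin n → Bool) (a b : Fin n) :
    LtStar (graphOf x) a b ↔ Relation.TransGen (edgeRel x) a b := by
  unfold LtStar
  have h : (fun u v => u < v ∧ (graphOf x).Adj u v) = edgeRel x := by
    funext u v
    refine propext ⟨?_, fun h => ⟨h.1, Or.inl h⟩⟩
    rintro ⟨huv, h | h⟩
    · exact h
    · exact absurd huv h.1.not_gt
  rw [h]

lemma prob_eq_expect (p : ℕ → unitInterval) (n : ℕ) (φ : vocabulary.Sentence) :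
    prob p n φ = expect (fun _ => bern (p n)) fun x =>
      ind (@Sentence.Realize vocabulary (Fin n) (model (graphOf x)) φ) :=
  binomialRandom_real_eq_expect _ _

/-- The probability that `φ` holds in the random model on `Fin n` with edge probability `p`. -/
noncomputable def bitProb (p : ℝ) (n : ℕ) (φ : vocabulary.Sentence) : ℝ :=
  expect (fun _ => bern p) fun x : Fin n × Fin n → Bool =>
    ind (@Sentence.Realize vocabulary (Fin n) (model (graphOf x)) φ)

/-- The probability that some pair is joined by a path, but by none with at most `w` steps. -/
noncomputable def longProb (w : ℕ) (p : ℝ) (n : ℕ) : ℝ :=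
  expect (fun _ => bern p) fun x : Fin n × Fin n → Bool =>
    ind (∃ a b, Relation.TransGen (edgeRel x) a b ∧ ¬Short w (edgeRel x) (fun _ => true) a b)

/-- Where every path can be shortened, the two structures coincide. -/
lemma abs_bitProb_sub_truncProb_le {w n : ℕ} {p : ℝ} (h0 : 0 ≤ p) (h1 : p ≤ 1)
    (φ : vocabulary.Sentence) : |bitProb p n φ - truncProb w p n φ| ≤ longProb w p n := by
  unfold bitProb truncProb longProb
  rw [← expect_sub]
  refine (abs_expect_le (fun _ => bern_nonneg h0 h1) _).trans
    (expect_mono (fun _ => bern_nonneg h0 h1) fun x => ?_)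
  by_cases hx : ∃ a b, Relation.TransGen (edgeRel x) a b ∧
      ¬Short w (edgeRel x) (fun _ => true) a b
  · rw [ind_of hx]
    exact (abs_ind_sub_le _ _).trans (ind_le_one _)
  · rw [ind_not hx]
    push Not at hx
    have h2 : model (graphOf x) = truncModel w (edgeRel x) := by
      have h3 : ∀ a b, LtStar (graphOf x) a b ↔ Short w (edgeRel x) (fun _ => true) a b := by
        intro a b
        rw [ltStar_graphOf]
        refine ⟨hx a b, ?_⟩
        rintro ⟨I, -, -, hp⟩
        exact Relation.TransGen.mono (fun u v h => h.1) _ _ hp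
      unfold model truncModel
      congr 1
      funext l R v
      cases R with
      | lt => rfl
      | ltStar => exact propext (h3 _ _)
    rw [h2, sub_self, abs_zero]

/-! ### Changing the edge probability -/

/-- The truth probability of any event depends continuously on the weights of the coins. -/
lemma abs_expect_bern_sub_sq_le {I : Type*} [Fintype I] [DecidableEq I] {p q : ℝ} (hp0 : 0 < p)
    (hp1 : p < 1) (h : (I → Bool) → ℝ) (hh : ∀ x, |h x| ≤ 1) :
    (expect (fun _ => bern q) h - expect (fun _ => bern p) h) ^ 2 ≤
      Real.exp (Fintype.card I * ((p - q) ^ 2 / (p * (1 - p)))) - 1 := by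
  have hb : ∀ b, 0 < bern p b := by
    intro b; cases b <;> simp only [bern] <;> linarith
  let W : ℝ → (I → Bool) → ℝ := fun p x => ∏ i, bern p (x i)
  have hW : ∀ x, 0 < W p x := fun x => Finset.prod_pos fun i _ => hb _
  have hsum : ∀ p, ∑ x, W p x = 1 := by
    intro p
    have := expect_one (I := I) (c := fun _ => bern p) fun _ => sum_bern p
    simpa [expect] using this
  -- One plus the chi-square distance is multiplicative over independent coordinates.
  have hsq : ∑ x, (W q x) ^ 2 / W p x = (1 + (p - q) ^ 2 / (p * (1 - p))) ^ Fintype.card I := by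
    have h1 : ∀ x : I → Bool, (W q x) ^ 2 / W p x = ∏ i, (bern q (x i) ^ 2 / bern p (x i)) := by
      intro x
      simp only [W, Finset.prod_div_distrib, Finset.prod_pow]
    simp only [h1]
    rw [← Fintype.piFinset_univ, ← Finset.prod_univ_sum (fun _ : I => (Finset.univ : Finset Bool))
      (fun _ b => bern q b ^ 2 / bern p b), Finset.prod_const, Finset.card_univ]
    congr 1
    have : 1 - p ≠ 0 := by linarith
    simp only [Fintype.sum_bool, bern]
    field_simp
    ring
  -- Cauchy–Schwarz with weights `W p` bounds the squared difference by the chi-square distance.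
  have hcs := Finset.sq_sum_div_le_sum_sq_div Finset.univ
    (fun x => (W q x - W p x) * h x) (g := W p) fun x _ => hW x
  rw [hsum, div_one] at hcs
  have hdiff : expect (fun _ => bern q) h - expect (fun _ => bern p) h =
      ∑ x, (W q x - W p x) * h x := by
    simp only [expect, W, sub_mul, Finset.sum_sub_distrib]
  rw [hdiff]
  refine hcs.trans ?_
  have hterm : ∀ x, ((W q x - W p x) * h x) ^ 2 / W p x ≤
      (W q x) ^ 2 / W p x - 2 * W q x + W p x := by
    intro x
    have h2 : (W q x) ^ 2 / W p x - 2 * W q x + W p x = (W q x - W p x) ^ 2 / W p x := by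
      field_simp [(hW x).ne']
      ring
    rw [h2, mul_pow]
    refine div_le_div_of_nonneg_right (mul_le_of_le_one_right (sq_nonneg _) ?_) (hW x).le
    rw [← sq_abs]
    exact pow_le_one₀ (abs_nonneg _) (hh x)
  refine (Finset.sum_le_sum fun x _ => hterm x).trans ?_
  rw [Finset.sum_add_distrib, Finset.sum_sub_distrib, ← Finset.mul_sum, hsum, hsum, hsq]
  have hexp : (1 + (p - q) ^ 2 / (p * (1 - p))) ^ Fintype.card I ≤
      Real.exp (Fintype.card I * ((p - q) ^ 2 / (p * (1 - p)))) := by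
    rw [Real.exp_nat_mul]
    refine pow_le_pow_left₀ ?_ ?_ _
    · have : 0 < 1 - p := by linarith
      positivity
    · rw [add_comm]; exact Real.add_one_le_exp _
  linarith

/-! ### Short paths in the random relation -/

section Chains

variable {N : ℕ}

/-- The element that precedes `v` in the increasing enumeration of `T ∪ {a}`. -/
def predIn (a : Fin N) (T : Finset (Fin N)) (v : Fin N) : Fin N :=
  (insert a (T.filter (· < v))).max' (Finset.insert_nonempty _ _)

/-- An increasing path is determined by its set of vertices, so that counting paths becomes counting
subsets. -/
lemma exists_chain_of_transGen {r : Fin N → Fin N → Prop} (hr : ∀ u v, r u v → u < v)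
    {a b : Fin N} (h : Relation.TransGen r a b) :
    ∃ T : Finset (Fin N), b ∈ T ∧ (∀ v ∈ T, a < v ∧ v ≤ b) ∧ ∀ v ∈ T, r (predIn a T v) v := by
  induction h with
  | @single b h =>
    refine ⟨{b}, by simp, by simpa using hr _ _ h, ?_⟩
    intro v hv
    obtain rfl := Finset.mem_singleton.1 hv
    have : predIn a {v} v = a := by
      simp [predIn, Finset.filter_singleton]
    rwa [this]
  | @tail b c _ h ih =>
    obtain ⟨T, hb, hT, hc⟩ := ih
    have hbc := hr _ _ h
    have hab := (hT b hb).1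
    refine ⟨insert c T, by simp, ?_, ?_⟩
    · intro v hv
      rcases Finset.mem_insert.1 hv with rfl | hv
      · exact ⟨hab.trans hbc, le_rfl⟩
      · exact ⟨(hT v hv).1, (hT v hv).2.trans hbc.le⟩
    · intro v hv
      rcases Finset.mem_insert.1 hv with rfl | hv
      · have h1 : predIn a (insert v T) v = b := by
          refine le_antisymm (Finset.max'_le _ _ _ ?_) (Finset.le_max' _ _ ?_)
          · intro u hu
            rcases Finset.mem_insert.1 hu with rfl | hu
            · exact hab.le
            · obtain ⟨hu, hlt⟩ := Finset.mem_filter.1 hu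
              rcases Finset.mem_insert.1 hu with rfl | hu
              · exact absurd hlt (lt_irrefl _)
              · exact (hT u hu).2
          · simp [hb, hbc]
        rwa [h1]
      · have h1 : (insert c T).filter (· < v) = T.filter (· < v) := by
          rw [Finset.filter_insert, if_neg]
          exact fun h2 => absurd (h2.trans_le (hT v hv).2) hbc.not_gt
        have h2 := hc v hv
        unfold predIn at h2 ⊢
        simpa only [h1] using h2

lemma transGen_of_chain {r : Fin N → Fin N → Prop} {a : Fin N} {T : Finset (Fin N)}
    (hc : ∀ v ∈ T, r (predIn a T v) v) (v : Fin N) (hv : v ∈ T) :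
    Relation.TransGen (fun u v => r u v ∧ v ∈ T) a v := by
  induction v using WellFoundedLT.induction with
  | _ v ih =>
    have hmem : predIn a T v ∈ insert a (T.filter (· < v)) := Finset.max'_mem _ _
    have hr := hc v hv
    rcases Finset.mem_insert.1 hmem with h | h
    · rw [h] at hr
      exact .single ⟨hr, hv⟩
    · obtain ⟨h1, h2⟩ := Finset.mem_filter.1 h
      exact (ih _ h2 h1).tail ⟨hr, hv⟩

/-- The vertices in the window of length `M` above `a`. -/
def window (M : ℕ) (a : Fin N) : Finset (Fin N) :=
  Finset.univ.filter fun v => a < v ∧ (v : ℕ) ≤ a + M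

lemma card_window_le (M : ℕ) (a : Fin N) : (window M a).card ≤ M := by
  have h : ((window M a).map Fin.valEmbedding) ⊆ Finset.Ioc (a : ℕ) (a + M) := by
    intro v hv
    obtain ⟨u, hu, rfl⟩ := Finset.mem_map.1 hv
    obtain ⟨-, h1, h2⟩ := Finset.mem_filter.1 hu
    exact Finset.mem_Ioc.2 ⟨h1, h2⟩
  have := Finset.card_le_card h
  rw [Finset.card_map, Nat.card_Ioc] at this
  omega

/-- There is a path of more than `K` steps within a window of length `M` above `a`. -/
def LongChain (M K : ℕ) (x : Fin N × Fin N → Bool) (a : Fin N) (T : Finset (Fin N)) : Prop :=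
  T ⊆ window M a ∧ K < T.card ∧ ∀ v ∈ T, x (predIn a T v, v) = true

/-- The edges into the elements of `T` are distinct, so a chain has probability `p ^ T.card`, at
most `2⁻ᴷ (2p) ^ T.card` when `K < T.card`. Summing `(2p) ^ T.card` over the subsets of the window
gives at most `(1 + 2 * p) ^ M`. -/
lemma expect_longChain_le {p : ℝ} (h0 : 0 ≤ p) (M K : ℕ) (a : Fin N) :
    ∑ T, expect (fun _ => bern p) (fun x => ind (LongChain M K x a T)) ≤
      (1 / 2) ^ K * (1 + 2 * p) ^ M := by
  have h1 : ∀ T : Finset (Fin N), T ∈ (window M a).powerset →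
      expect (fun _ => bern p) (fun x => ind (LongChain M K x a T)) ≤
        (1 / 2) ^ K * ∏ _v ∈ T, (2 * p) := by
    intro T hT
    by_cases hK : K < T.card
    · have h2 : ∀ x : Fin N × Fin N → Bool, LongChain M K x a T ↔
          ∀ e ∈ T.image (fun v => (predIn a T v, v)), x e = true := by
        intro x
        simp only [LongChain, Finset.mem_powerset.1 hT, hK, true_and, Finset.forall_mem_image]
      simp only [h2]
      rw [expect_forall_mem (fun _ => sum_bern p) _ fun _ => true, Finset.prod_const,
        Finset.card_image_of_injective _ (fun u v h => congrArg Prod.snd h), Finset.prod_const,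
        mul_pow, ← mul_assoc]
      refine le_mul_of_one_le_left (pow_nonneg h0 _) ?_
      obtain ⟨j, hj⟩ := Nat.exists_eq_add_of_le hK.le
      rw [hj, pow_add, ← mul_assoc, ← mul_pow]
      norm_num
      exact one_le_pow₀ (by norm_num)
    · have h2 : ∀ x : Fin N × Fin N → Bool, ind (LongChain M K x a T) = 0 :=
        fun x => ind_not fun h => hK h.2.1
      simp only [h2]
      have h3 : expect (fun _ : Fin N × Fin N => bern p) (fun _ => 0) = 0 := by simp [expect]
      rw [h3]
      exact mul_nonneg (by positivity) (Finset.prod_nonneg fun _ _ => by linarith)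
  have h2 : ∀ T ∉ (window M a).powerset,
      expect (fun _ => bern p) (fun x => ind (LongChain M K x a T)) = 0 := by
    intro T hT
    have h2 : ∀ x : Fin N × Fin N → Bool, ind (LongChain M K x a T) = 0 :=
      fun x => ind_not fun h => hT (Finset.mem_powerset.2 h.1)
    simp [h2, expect]
  rw [← Finset.sum_subset (Finset.subset_univ (window M a).powerset) fun T _ hT => h2 T hT]
  refine (Finset.sum_le_sum h1).trans ?_
  rw [← Finset.mul_sum, ← Finset.prod_one_add, Finset.prod_const]
  exact mul_le_mul_of_nonneg_left
    (pow_le_pow_right₀ (by linarith) (card_window_le M a)) (by positivity)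

lemma short_of_transGen {M K : ℕ} {x : Fin N × Fin N → Bool}
    (hx : ¬∃ a T, LongChain M K x a T) {a b : Fin N} (hab : (b : ℕ) ≤ a + M)
    (h : Relation.TransGen (edgeRel x) a b) : Short K (edgeRel x) (fun _ => true) a b := by
  obtain ⟨T, hb, hT, hc⟩ := exists_chain_of_transGen (fun _ _ h => h.1) h
  refine ⟨T, ?_, by simp, transGen_of_chain hc b hb⟩
  by_contra hK
  refine hx ⟨a, T, ?_, not_le.1 hK, fun v hv => (hc v hv).2⟩
  intro v hv
  refine Finset.mem_filter.2 ⟨Finset.mem_univ _, (hT v hv).1, ?_⟩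
  exact (Fin.le_def.1 (hT v hv).2).trans hab

end Chains

/-! ### Unlikelihood of sets with too few outgoing or incoming edges. -/

section Expansion

variable {N : ℕ}

/-- The `l` vertices from `b` on. -/
def block (l : ℕ) (b : Fin N) : Finset (Fin N) :=
  Finset.univ.filter fun v => b ≤ v ∧ (v : ℕ) < b + l

lemma card_block {l : ℕ} {b : Fin N} (h : b + l ≤ N) : (block l b).card = l := by
  have h : (block l b).map Fin.valEmbedding = Finset.Ico (b : ℕ) (b + l) := by
    ext v
    simp only [block, Finset.mem_map, Finset.mem_filter, Finset.mem_univ, true_and,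
      Fin.valEmbedding_apply, Finset.mem_Ico, Fin.le_def]
    constructor
    · rintro ⟨u, hu, rfl⟩
      exact hu
    · intro hv
      exact ⟨⟨v, by omega⟩, hv, rfl⟩
  have := congrArg Finset.card h
  rw [Finset.card_map, Nat.card_Ico] at this
  omega

/-- The sizes for which a lack of edges between `A` and all of a block but `C` is unlikely. -/
def Sizes (t : ℕ) (A C : Finset (Fin N)) (b : Fin N) : Prop :=
  A.Nonempty ∧ C.card ≤ A.card ∧ A.card ≤ 2 * t ∧ b + 4 * t ≤ N

/-- No edge goes up from `A` to a vertex outside `C` of a block. -/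
def NoEdgeUp (t : ℕ) (x : Fin N × Fin N → Bool) (b : Fin N) (A C : Finset (Fin N)) : Prop :=
  Sizes t A C b ∧ ∀ a ∈ A, ∀ v ∈ block (4 * t) b \ C, x (a, v) = false

/-- No edge goes down from `A` to a vertex outside `C` of a block. -/
def NoEdgeDown (t : ℕ) (x : Fin N × Fin N → Bool) (b : Fin N) (A C : Finset (Fin N)) : Prop :=
  Sizes t A C b ∧ ∀ v ∈ block (4 * t) b \ C, ∀ a ∈ A, x (v, a) = false

/-- There is no edge between two large sets. -/
def NoEdgeLarge (t : ℕ) (x : Fin N × Fin N → Bool) (A C : Finset (Fin N)) : Prop :=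
  2 * t ≤ A.card ∧ 2 * t ≤ C.card ∧ ∀ a ∈ A, ∀ c ∈ C, x (a, c) = false

lemma expect_noEdge {p : ℝ} (A D : Finset (Fin N)) :
    expect (fun _ => bern p) (fun x => ind (∀ a ∈ A, ∀ v ∈ D, x (a, v) = false)) =
      (1 - p) ^ (A.card * D.card) := by
  have h : ∀ x : Fin N × Fin N → Bool,
      (∀ a ∈ A, ∀ v ∈ D, x (a, v) = false) ↔ ∀ e ∈ A ×ˢ D, x e = false := by
    intro x
    simp only [Finset.mem_product, Prod.forall]
    exact ⟨fun h a v hav => h a hav.1 v hav.2, fun h a ha v hv => h a v ⟨ha, hv⟩⟩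
  simp only [h]
  rw [expect_forall_mem (fun _ => sum_bern p) _ fun _ => false, Finset.prod_const,
    Finset.card_product, bern]

/-- At least `2 * t` vertices of the block lie outside `C`, and `A.card + C.card ≤ 2 * A.card`. So
the number of absent edges is large enough to pay for the choice of both `A` and `C`. -/
lemma Sizes.le {t : ℕ} {A C : Finset (Fin N)} {b : Fin N} (h : Sizes t A C b) :
    t * (A.card + C.card) ≤ A.card * (block (4 * t) b \ C).card := by
  obtain ⟨-, h1, h2, h3⟩ := h
  have h4 := Finset.le_card_sdiff C (block (4 * t) b)
  rw [card_block h3] at h4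
  have h5 : 2 * t ≤ (block (4 * t) b \ C).card := by omega
  nlinarith

variable {t : ℕ} {p : ℝ}

/-- The weight that bounds the probabilities of the various events without edges. -/
noncomputable def pairWt (θ : ℝ) (A C : Finset (Fin N)) : ℝ :=
  ind A.Nonempty * (θ ^ A.card * θ ^ C.card)

lemma expect_le_pairWt (h0 : 0 ≤ p) (h1 : p ≤ 1) {A C : Finset (Fin N)} {P : Prop}
    {E E' : (Fin N × Fin N → Bool) → Prop} (hE : ∀ x, E x → P ∧ E' x) (hA : P → A.Nonempty)
    {j : ℕ} (hj : P → t * (A.card + C.card) ≤ j)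
    (hE' : expect (fun _ => bern p) (fun x => ind (E' x)) = (1 - p) ^ j) :
    expect (fun _ => bern p) (fun x => ind (E x)) ≤ pairWt ((1 - p) ^ t) A C := by
  have hθ : 0 ≤ (1 - p) ^ t := pow_nonneg (by linarith) t
  by_cases hP : P
  · refine (expect_mono (fun _ => bern_nonneg h0 h1) fun x => ind_mono fun h => (hE x h).2).trans ?_
    rw [hE', pairWt, ind_of (hA hP), one_mul, ← pow_add, ← pow_mul]
    exact pow_le_pow_of_le_one (by linarith) (by linarith) (hj hP)
  · have h2 : ∀ x, ind (E x) = 0 := fun x => ind_not fun h => hP (hE x h).1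
    have h3 : expect (fun _ : Fin N × Fin N => bern p) (fun _ => 0) = 0 := by simp [expect]
    simp only [h2, h3]
    exact mul_nonneg (ind_nonneg _) (by positivity)

lemma expect_noEdgeUp_le (h0 : 0 ≤ p) (h1 : p ≤ 1) (b : Fin N) (A C : Finset (Fin N)) :
    expect (fun _ => bern p) (fun x => ind (NoEdgeUp t x b A C)) ≤ pairWt ((1 - p) ^ t) A C :=
  expect_le_pairWt h0 h1 (fun _ h => h) And.left Sizes.le (expect_noEdge _ _)

lemma expect_noEdgeDown_le (h0 : 0 ≤ p) (h1 : p ≤ 1) (b : Fin N) (A C : Finset (Fin N)) :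
    expect (fun _ => bern p) (fun x => ind (NoEdgeDown t x b A C)) ≤ pairWt ((1 - p) ^ t) A C :=
  expect_le_pairWt h0 h1 (fun _ h => h) And.left (fun h => h.le.trans_eq (mul_comm _ _))
    (expect_noEdge _ _)

lemma expect_noEdgeLarge_le (h0 : 0 ≤ p) (h1 : p ≤ 1) (ht : 1 ≤ t) (A C : Finset (Fin N)) :
    expect (fun _ => bern p) (fun x => ind (NoEdgeLarge t x A C)) ≤ pairWt ((1 - p) ^ t) A C := by
  refine expect_le_pairWt (P := 2 * t ≤ A.card ∧ 2 * t ≤ C.card) h0 h1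
    (fun x h => ⟨⟨h.1, h.2.1⟩, h.2.2⟩) (fun h => Finset.card_pos.1 (by omega)) (fun h => ?_)
    (expect_noEdge A C)
  nlinarith [Nat.mul_le_mul_right A.card h.2, Nat.mul_le_mul_right C.card h.1]

/-- The `- 1` comes from excluding the empty `A`; it makes the sum small as soon as `N * θ` is
small. -/
lemma sum_pairWt (θ : ℝ) :
    ∑ A : Finset (Fin N), ∑ C : Finset (Fin N), pairWt θ A C =
      ((1 + θ) ^ N - 1) * (1 + θ) ^ N := by
  have h1 : ∑ C : Finset (Fin N), θ ^ C.card = (1 + θ) ^ N := by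
    have := Finset.prod_one_add (s := (Finset.univ : Finset (Fin N))) (f := fun _ => θ)
    simp only [Finset.prod_const, Finset.card_univ, Fintype.card_fin, Finset.powerset_univ] at this
    exact this.symm
  have h2 : ∑ A : Finset (Fin N), ind A.Nonempty * θ ^ A.card = (1 + θ) ^ N - 1 := by
    rw [← h1, ← Finset.sum_erase_add _ _ (Finset.mem_univ (∅ : Finset (Fin N))),
      ← Finset.sum_erase_add (Finset.univ : Finset (Finset (Fin N))) _ (Finset.mem_univ ∅)]
    have h3 : ∀ A ∈ Finset.univ.erase (∅ : Finset (Fin N)), ind A.Nonempty * θ ^ A.card =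
        θ ^ A.card := by
      intro A hA
      rw [ind_of (Finset.nonempty_iff_ne_empty.2 (Finset.ne_of_mem_erase hA)), one_mul]
    rw [Finset.sum_congr rfl h3]
    simp [ind]
  simp only [pairWt, ← mul_assoc, ← Finset.mul_sum, h1]
  rw [← Finset.sum_mul, h2]

end Expansion

/-! ### Doubling of reachable sets and shortening of paths. -/

section Growth

variable {N t J : ℕ} {x : Fin N × Fin N → Bool}

/-- If few vertices fail to expand, the sizes of the sets `S i` double up to `2 * t`. -/
lemma two_mul_le_card_of_doubling (S : ℕ → Finset (Fin N)) (hJ : 2 * t ≤ 2 ^ J)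
    (h0 : (S 0).Nonempty) (hmono : Monotone S)
    (hS : ∀ i < J, (S i).Nonempty → (S i).card ≤ 2 * t →
      (S i).card < (S (i + 1) \ S i).card) : 2 * t ≤ (S J).card := by
  have key : ∀ i ≤ J, 2 ^ i ≤ (S i).card ∨ 2 * t ≤ (S i).card := by
    intro i
    induction i with
    | zero => exact fun _ => Or.inl (Finset.card_pos.2 h0)
    | succ i ih =>
      intro hi
      have hsub : S i ⊆ S (i + 1) := hmono (Nat.le_succ i)
      by_cases ht : 2 * t ≤ (S i).card
      · exact Or.inr (ht.trans (Finset.card_le_card hsub))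
      · left
        have h1 := (ih (by omega)).resolve_right ht
        have h2 := hS i (by omega) (h0.mono (hmono (Nat.zero_le i))) (by omega)
        rw [Finset.card_sdiff_of_subset hsub] at h2
        rw [pow_succ]
        omega
  rcases key J le_rfl with h | h
  · exact hJ.trans h
  · exact h

open Classical in
-- `S i` is the part of the vertices reachable from `a` that lies within `i` blocks after `a`. Every
-- edge from `S i` into the next block ends in `S (i + 1) \ S i`; were this no larger than `S i`,
-- the pair would violate `hx`.
lemma two_mul_le_card_up (hJ : 2 * t ≤ 2 ^ J) (hx : ¬∃ b A C, NoEdgeUp t x b A C) (a : Fin N)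
    (ha : a + 1 + 4 * t * J ≤ N) :
    2 * t ≤ (Finset.univ.filter fun v : Fin N => Relation.ReflTransGen (edgeRel x) a v ∧
      (v : ℕ) < a + 1 + 4 * t * J).card := by
  let S : ℕ → Finset (Fin N) := fun i => Finset.univ.filter fun v : Fin N =>
    Relation.ReflTransGen (edgeRel x) a v ∧ (v : ℕ) < a + 1 + 4 * t * i
  have hS : ∀ i v, v ∈ S i ↔ Relation.ReflTransGen (edgeRel x) a v ∧
      (v : ℕ) < a + 1 + 4 * t * i := by simp [S]
  refine two_mul_le_card_of_doubling S hJ ⟨a, (hS 0 a).2 ⟨.refl, by omega⟩⟩ ?_ ?_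
  · intro i j hij v hv
    rw [hS] at hv ⊢
    have := Nat.mul_le_mul_left (4 * t) hij
    exact ⟨hv.1, by omega⟩
  · intro i hi hne hle
    by_contra hlt
    have hiJ : 4 * t * (i + 1) ≤ 4 * t * J := Nat.mul_le_mul_left _ hi
    have ht : 0 < t := by have := Finset.card_pos.2 hne; omega
    have hb : a + 1 + 4 * t * i < N := by
      rw [mul_add, mul_one] at hiJ; omega
    refine hx ⟨⟨a + 1 + 4 * t * i, hb⟩, S i, S (i + 1) \ S i, ⟨hne, by omega, hle, ?_⟩, ?_⟩
    · rw [mul_add, mul_one] at hiJ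
      show a + 1 + 4 * t * i + 4 * t ≤ N
      omega
    · intro u hu v hv
      by_contra hxu
      obtain ⟨hv1, hv2⟩ := Finset.mem_sdiff.1 hv
      obtain ⟨-, hv3, hv4⟩ := Finset.mem_filter.1 hv1
      have hv3 : a + 1 + 4 * t * i ≤ (v : ℕ) := hv3
      have hv4 : (v : ℕ) < a + 1 + 4 * t * i + 4 * t := hv4
      have hu := (hS i u).1 hu
      refine hv2 (Finset.mem_sdiff.2 ⟨(hS _ _).2 ⟨hu.1.tail ⟨?_, by simpa using hxu⟩, ?_⟩, ?_⟩)
      · exact Fin.lt_def.2 (by omega)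
      · rw [mul_add, mul_one]; omega
      · intro h
        have := ((hS _ _).1 h).2
        omega

open Classical in
-- The mirror image, with blocks going down from `a`.
lemma two_mul_le_card_down (hJ : 2 * t ≤ 2 ^ J) (hx : ¬∃ b A C, NoEdgeDown t x b A C) (a : Fin N)
    (ha : 4 * t * J ≤ a) :
    2 * t ≤ (Finset.univ.filter fun v : Fin N => Relation.ReflTransGen (edgeRel x) v a ∧
      (a : ℕ) ≤ v + 4 * t * J).card := by
  let S : ℕ → Finset (Fin N) := fun i => Finset.univ.filter fun v : Fin N =>
    Relation.ReflTransGen (edgeRel x) v a ∧ (a : ℕ) ≤ v + 4 * t * i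
  have hS : ∀ i v, v ∈ S i ↔ Relation.ReflTransGen (edgeRel x) v a ∧
      (a : ℕ) ≤ v + 4 * t * i := by simp [S]
  have haN := a.isLt
  refine two_mul_le_card_of_doubling S hJ ⟨a, (hS 0 a).2 ⟨.refl, by omega⟩⟩ ?_ ?_
  · intro i j hij v hv
    rw [hS] at hv ⊢
    have := Nat.mul_le_mul_left (4 * t) hij
    exact ⟨hv.1, by omega⟩
  · intro i hi hne hle
    by_contra hlt
    have hiJ : 4 * t * (i + 1) ≤ 4 * t * J := Nat.mul_le_mul_left _ hi
    have ht : 0 < t := by have := Finset.card_pos.2 hne; omega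
    rw [mul_add, mul_one] at hiJ
    refine hx ⟨⟨a - (4 * t * i + 4 * t), by omega⟩, S i, S (i + 1) \ S i,
      ⟨hne, by omega, hle, ?_⟩, ?_⟩
    · show a - (4 * t * i + 4 * t) + 4 * t ≤ N
      omega
    · intro v hv u hu
      by_contra hxu
      obtain ⟨hv1, hv2⟩ := Finset.mem_sdiff.1 hv
      obtain ⟨-, hv3, hv4⟩ := Finset.mem_filter.1 hv1
      have hv3 : a - (4 * t * i + 4 * t) ≤ (v : ℕ) := hv3
      have hv4 : (v : ℕ) < a - (4 * t * i + 4 * t) + 4 * t := hv4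
      have hu := (hS i u).1 hu
      refine hv2 (Finset.mem_sdiff.2 ⟨(hS _ _).2 ⟨.head ⟨?_, by simpa using hxu⟩ hu.1, ?_⟩, ?_⟩)
      · exact Fin.lt_def.2 (by omega)
      · rw [mul_add, mul_one]; omega
      · intro h
        have := ((hS _ _).1 h).2
        omega

lemma exists_short_reflTransGen {M K : ℕ} (hx : ¬∃ a T, LongChain M K x a T) {a b : Fin N}
    (hab : (b : ℕ) ≤ a + M) (h : Relation.ReflTransGen (edgeRel x) a b) :
    ∃ I : Finset (Fin N), I.card ≤ K ∧
      Relation.ReflTransGen (fun u v => edgeRel x u v ∧ v ∈ I) a b := by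
  rcases Relation.reflTransGen_iff_eq_or_transGen.1 h with rfl | h
  · exact ⟨∅, by simp, .refl⟩
  · obtain ⟨I, hI, -, hp⟩ := short_of_transGen hx hab h
    exact ⟨I, hI, hp.to_reflTransGen⟩

/-- For distant `a` and `b` the set grown up from `a` lies wholly below the set grown down from `b`,
and some edge joins them. The two outer pieces lie in windows, so they need at most `K` vertices
each; the head of the joining edge is the extra 1. -/
lemma short_of_expansion {K : ℕ} (hJ : 2 * t ≤ 2 ^ J)
    (hc : ¬∃ a T, LongChain (2 * (4 * t * J + 1)) K x a T) (hu : ¬∃ b A C, NoEdgeUp t x b A C)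
    (hd : ¬∃ b A C, NoEdgeDown t x b A C) (hl : ¬∃ A C, NoEdgeLarge t x A C) {a b : Fin N}
    (h : Relation.TransGen (edgeRel x) a b) :
    Short (2 * K + 1) (edgeRel x) (fun _ => true) a b := by
  classical
  by_cases hab : (b : ℕ) ≤ a + 2 * (4 * t * J + 1)
  · obtain ⟨I, hI, h1, h2⟩ := short_of_transGen hc hab h
    exact ⟨I, by omega, h1, h2⟩
  have hbN := b.isLt
  have hA := two_mul_le_card_up hJ hu a (by omega)
  have hC := two_mul_le_card_down hJ hd b (by omega)
  by_contra hns
  refine hl ⟨_, _, hA, hC, fun u hu v hv => ?_⟩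
  obtain ⟨-, hu1, hu2⟩ := Finset.mem_filter.1 hu
  obtain ⟨-, hv1, hv2⟩ := Finset.mem_filter.1 hv
  by_contra hxu
  obtain ⟨I, hI, hp⟩ := exists_short_reflTransGen hc (by omega) hu1
  obtain ⟨I', hI', hp'⟩ := exists_short_reflTransGen hc (by omega) hv1
  refine hns ⟨insert v (I ∪ I'), ?_, by simp, ?_⟩
  · refine (Finset.card_insert_le _ _).trans ?_
    have := Finset.card_union_le I I'
    omega
  · have e1 : Relation.ReflTransGen (fun u w => edgeRel x u w ∧ w ∈ insert v (I ∪ I')) a u :=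
      Relation.ReflTransGen.mono (fun _ _ h => ⟨h.1, by simp [h.2]⟩) _ _ hp
    have e2 : Relation.ReflTransGen (fun u w => edgeRel x u w ∧ w ∈ insert v (I ∪ I')) v b :=
      Relation.ReflTransGen.mono (fun _ _ h => ⟨h.1, by simp [h.2]⟩) _ _ hp'
    have huv : edgeRel x u v := ⟨Fin.lt_def.2 (by omega), by simpa using hxu⟩
    exact (Relation.TransGen.trans_right e1 (.single ⟨huv, by simp⟩)).trans_left e2

/-- With high probability all paths can be shortened. -/
theorem longProb_le {K : ℕ} {p : ℝ} (h0 : 0 ≤ p) (h1 : p ≤ 1) (ht : 1 ≤ t) (hJ : 2 * t ≤ 2 ^ J) :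
    longProb (2 * K + 1) p N ≤ N * ((1 / 2) ^ K * (1 + 2 * p) ^ (2 * (4 * t * J + 1))) +
      (2 * N + 1) * (((1 + (1 - p) ^ t) ^ N - 1) * (1 + (1 - p) ^ t) ^ N) := by
  classical
  have hb : ∀ (_ : Fin N × Fin N) b, 0 ≤ bern p b := fun _ => bern_nonneg h0 h1
  let M := 2 * (4 * t * J + 1)
  -- Union bound over the four obstructions. The `N` positions of a block, upwards and downwards,
  -- and one term for large sets give the factor `2 * N + 1`.
  have hsplit : longProb (2 * K + 1) p N ≤
      expect (fun _ => bern p) fun x : Fin N × Fin N → Bool =>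
        ind (∃ z : Fin N × Finset (Fin N), LongChain M K x z.1 z.2) +
        ind (∃ z : Fin N × Finset (Fin N) × Finset (Fin N), NoEdgeUp t x z.1 z.2.1 z.2.2) +
        ind (∃ z : Fin N × Finset (Fin N) × Finset (Fin N), NoEdgeDown t x z.1 z.2.1 z.2.2) +
        ind (∃ z : Finset (Fin N) × Finset (Fin N), NoEdgeLarge t x z.1 z.2) := by
    refine expect_mono hb fun x => ?_
    refine le_trans (ind_mono ?_) ((ind_or_le _ _).trans (add_le_add_left ((ind_or_le _ _).trans
      (add_le_add_left (ind_or_le _ _) _)) _))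
    rintro ⟨a, b, hab, hns⟩
    by_contra hno
    push Not at hno
    obtain ⟨⟨⟨hc, hu⟩, hd⟩, hl⟩ := hno
    refine hns (short_of_expansion hJ ?_ ?_ ?_ ?_ hab)
    · rintro ⟨a, T, h⟩; exact hc (a, T) h
    · rintro ⟨b, A, C, h⟩; exact hu (b, A, C) h
    · rintro ⟨b, A, C, h⟩; exact hd (b, A, C) h
    · rintro ⟨A, C, h⟩; exact hl (A, C) h
  refine hsplit.trans ?_
  rw [expect_add, expect_add, expect_add]
  set P := ((1 + (1 - p) ^ t) ^ N - 1) * (1 + (1 - p) ^ t) ^ N with hP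
  have hchain : expect (fun _ => bern p) (fun x : Fin N × Fin N → Bool =>
      ind (∃ z : Fin N × Finset (Fin N), LongChain M K x z.1 z.2)) ≤
        N * ((1 / 2) ^ K * (1 + 2 * p) ^ M) := by
    refine (expect_union hb fun x h => h).trans ?_
    rw [Fintype.sum_prod_type]
    refine (Finset.sum_le_sum fun a _ => expect_longChain_le h0 M K a).trans ?_
    simp
  have hup : expect (fun _ => bern p) (fun x : Fin N × Fin N → Bool =>
      ind (∃ z : Fin N × Finset (Fin N) × Finset (Fin N), NoEdgeUp t x z.1 z.2.1 z.2.2)) ≤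
        N * P := by
    refine (expect_union hb fun x h => h).trans ?_
    simp only [Fintype.sum_prod_type]
    refine (Finset.sum_le_sum fun b _ => Finset.sum_le_sum fun A _ => Finset.sum_le_sum fun C _ =>
      expect_noEdgeUp_le h0 h1 b A C).trans ?_
    rw [sum_pairWt]
    simp [hP]
  have hdown : expect (fun _ => bern p) (fun x : Fin N × Fin N → Bool =>
      ind (∃ z : Fin N × Finset (Fin N) × Finset (Fin N), NoEdgeDown t x z.1 z.2.1 z.2.2)) ≤
        N * P := by
    refine (expect_union hb fun x h => h).trans ?_
    simp only [Fintype.sum_prod_type]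
    refine (Finset.sum_le_sum fun b _ => Finset.sum_le_sum fun A _ => Finset.sum_le_sum fun C _ =>
      expect_noEdgeDown_le h0 h1 b A C).trans ?_
    rw [sum_pairWt]
    simp [hP]
  have hlarge : expect (fun _ => bern p) (fun x : Fin N × Fin N → Bool =>
      ind (∃ z : Finset (Fin N) × Finset (Fin N), NoEdgeLarge t x z.1 z.2)) ≤ P := by
    refine (expect_union hb fun x h => h).trans ?_
    simp only [Fintype.sum_prod_type]
    refine (Finset.sum_le_sum fun A _ => Finset.sum_le_sum fun C _ =>
      expect_noEdgeLarge_le h0 h1 ht A C).trans ?_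
    rw [sum_pairWt]
  linarith

end Growth

/-! ### Asymptotics -/

lemma longProb_le_pow {l N : ℕ} {p : ℝ} (hl : 1 ≤ l) (hp0 : 0 < p) (hp1 : p ≤ 1)
    (hN : (N : ℝ) ≤ 2 ^ l) (hp : 1 / p ≤ 2 ^ l) :
    longProb (2 * (650 * l ^ 2) + 1) p N ≤ 19 * (1 / 2) ^ l := by
  have hl' : (1 : ℝ) ≤ l := by exact_mod_cast hl
  -- This `t` makes `(1 - p) ^ t ≤ exp (-3l)`, small enough to beat `N ^ 2 ≤ 2 ^ (2l)`, while `p *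
  -- t` stays of order `l`.
  set t := ⌈3 * (l : ℝ) / p⌉₊ with ht
  have ht1 : 3 * (l : ℝ) / p ≤ t := Nat.le_ceil _
  have ht2 : (t : ℝ) < 3 * l / p + 1 := Nat.ceil_lt_add_one (by positivity)
  have ht0 : 1 ≤ t := Nat.ceil_pos.2 (by positivity)
  have htp1 : 3 * (l : ℝ) ≤ p * t := by
    rw [mul_comm p]; exact (div_le_iff₀ hp0).1 ht1
  have htp2 : p * t ≤ 3 * l + 1 := by
    have h := mul_le_mul_of_nonneg_left ht2.le hp0.le
    have h2 : p * (3 * l / p + 1) = 3 * l + p := by field_simp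
    linarith
  -- From `t ≤ 3 * 4 ^ l + 1 ≤ 4 * 4 ^ l`.
  have hJ : 2 * t ≤ 2 ^ (2 * l + 3) := by
    have h1 : (l : ℝ) ≤ 2 ^ l := by exact_mod_cast Nat.lt_two_pow_self.le
    have h2 : (1 : ℝ) ≤ 2 ^ l := one_le_pow₀ (by norm_num)
    have h3 : 3 * (l : ℝ) / p ≤ 3 * 2 ^ l * 2 ^ l := by
      rw [div_eq_mul_one_div]
      exact mul_le_mul (by linarith) hp (by positivity) (by positivity)
    have h4 : (2 : ℝ) * t ≤ 2 ^ (2 * l + 3) := by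
      rw [pow_add, two_mul l, pow_add]
      nlinarith
    exact_mod_cast h4
  refine (longProb_le (t := t) (J := 2 * l + 3) (K := 650 * l ^ 2) hp0.le hp1 ht0 hJ).trans ?_
  have hchain : (N : ℝ) * ((1 / 2) ^ (650 * l ^ 2) *
      (1 + 2 * p) ^ (2 * (4 * t * (2 * l + 3) + 1))) ≤ (1 / 2) ^ l := by
    have h1 : (1 + 2 * p) ^ (2 * (4 * t * (2 * l + 3) + 1)) ≤ 2 ^ (648 * l ^ 2) := by
      have h2 : 1 + 2 * p ≤ Real.exp (2 * p) := by
        rw [add_comm]; exact Real.add_one_le_exp _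
      refine (pow_le_pow_left₀ (by linarith) h2 _).trans ?_
      rw [← Real.exp_nat_mul]
      -- With `p * t ≤ 3l + 1 ≤ 4l` and `2l + 3 ≤ 5l`, the left side is at most `16 * 4l * 5l + 4 ≤
      -- 324 l²`. Then `e ≤ 4` doubles the exponent to `648 l²`, and `650 l²` leaves `2 l²` to
      -- absorb `N`.
      have h3 : ((2 * (4 * t * (2 * l + 3) + 1) : ℕ) : ℝ) * (2 * p) ≤ ((324 * l ^ 2 : ℕ) : ℝ) := by
        push_cast
        nlinarith [mul_le_mul_of_nonneg_right htp2 (by linarith : (0 : ℝ) ≤ 2 * l + 3),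
          mul_le_mul_of_nonneg_left hl' (by linarith : (0 : ℝ) ≤ l)]
      have h4 : ∀ j : ℕ, Real.exp j ≤ 2 ^ (2 * j) := by
        intro j
        rw [← Real.exp_one_pow, pow_mul]
        exact pow_le_pow_left₀ (Real.exp_pos _).le (by linarith [Real.exp_one_lt_d9]) _
      refine (Real.exp_le_exp.2 h3).trans ((h4 _).trans (le_of_eq ?_))
      rw [show 648 * l ^ 2 = 2 * (324 * l ^ 2) by ring]
    have h4 : (1 / 2 : ℝ) ^ (650 * l ^ 2) * 2 ^ (648 * l ^ 2) = (1 / 2) ^ (2 * l ^ 2) := by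
      rw [show 650 * l ^ 2 = 2 * l ^ 2 + 648 * l ^ 2 by ring, pow_add, mul_assoc, ← mul_pow]
      norm_num
    have h5 : (1 / 2 : ℝ) ^ (2 * l ^ 2) ≤ (1 / 2) ^ (l + l) :=
      pow_le_pow_of_le_one (by norm_num) (by norm_num) (by nlinarith)
    calc (N : ℝ) * ((1 / 2) ^ (650 * l ^ 2) * (1 + 2 * p) ^ (2 * (4 * t * (2 * l + 3) + 1)))
        ≤ 2 ^ l * ((1 / 2) ^ (650 * l ^ 2) * 2 ^ (648 * l ^ 2)) := by gcongr
      _ ≤ 2 ^ l * (1 / 2) ^ (l + l) := by rw [h4]; gcongr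
      _ = (1 / 2) ^ l := by rw [pow_add, ← mul_assoc, ← mul_pow]; norm_num
  set θ := (1 - p) ^ t with hθ
  have hθ0 : 0 ≤ θ := pow_nonneg (by linarith) t
  have hθ1 : θ ≤ (1 / 2) ^ (3 * l) := by
    have h1 : 1 - p ≤ Real.exp (-p) := by
      have := Real.add_one_le_exp (-p); linarith
    refine (pow_le_pow_left₀ (by linarith) h1 t).trans ?_
    rw [← Real.exp_nat_mul]
    have h2 : (t : ℝ) * -p ≤ ((3 * l : ℕ) : ℝ) * (-1) := by push_cast; linarith
    refine (Real.exp_le_exp.2 h2).trans ?_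
    rw [Real.exp_nat_mul]
    refine pow_le_pow_left₀ (Real.exp_pos _).le ?_ _
    rw [Real.exp_neg, one_div]
    refine inv_anti₀ (by norm_num) ?_
    have := Real.add_one_le_exp (1 : ℝ)
    linarith
  have hhalf : (1 / 2 : ℝ) ^ l ≤ 1 := pow_le_one₀ (by norm_num) (by norm_num)
  have hhalf0 : (0 : ℝ) < (1 / 2) ^ l := by positivity
  have hprod : (2 : ℝ) ^ l * (1 / 2) ^ l = 1 := by rw [← mul_pow]; norm_num
  set δ := (N : ℝ) * θ with hδ
  have hδ0 : 0 ≤ δ := by positivity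
  have hδ1 : δ ≤ (1 / 2) ^ l * (1 / 2) ^ l := by
    calc δ ≤ 2 ^ l * (1 / 2) ^ (3 * l) := mul_le_mul hN hθ1 hθ0 (by positivity)
      _ = (2 ^ l * (1 / 2) ^ l) * ((1 / 2) ^ l * (1 / 2) ^ l) := by
        rw [show 3 * l = l + l + l by ring, pow_add, pow_add]; ring
      _ = _ := by rw [hprod, one_mul]
  have hδ2 : δ ≤ 1 := hδ1.trans (mul_le_one₀ hhalf hhalf0.le hhalf)
  have hpow : (1 + θ) ^ N ≤ Real.exp δ := by
    rw [hδ, Real.exp_nat_mul]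
    exact pow_le_pow_left₀ (by linarith) (by rw [add_comm]; exact Real.add_one_le_exp _) N
  have hexp : Real.exp δ - 1 ≤ 2 * δ := by
    have h1 := Real.abs_exp_sub_one_le (x := δ) (by rwa [abs_of_nonneg hδ0])
    rw [abs_of_nonneg hδ0] at h1
    exact (le_abs_self _).trans h1
  have h1 : ((1 + θ) ^ N - 1) * (1 + θ) ^ N ≤ 2 * δ * 3 := by
    have h2 : (1 : ℝ) ≤ (1 + θ) ^ N := one_le_pow₀ (by linarith)
    exact mul_le_mul (by linarith) (by linarith) (by linarith) (by linarith)
  have h2 : (2 * (N : ℝ) + 1) * (((1 + θ) ^ N - 1) * (1 + θ) ^ N) ≤ 18 * (1 / 2) ^ l := by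
    have h3 : (1 : ℝ) ≤ 2 ^ l := one_le_pow₀ (by norm_num)
    calc (2 * (N : ℝ) + 1) * (((1 + θ) ^ N - 1) * (1 + θ) ^ N)
        ≤ (3 * 2 ^ l) * (2 * δ * 3) := by
          refine mul_le_mul (by linarith) h1 ?_ (by positivity)
          exact mul_nonneg (sub_nonneg.2 (one_le_pow₀ (by linarith))) (by positivity)
      _ ≤ (3 * 2 ^ l) * (2 * ((1 / 2) ^ l * (1 / 2) ^ l) * 3) := by gcongr
      _ = 18 * (2 ^ l * (1 / 2) ^ l) * (1 / 2) ^ l := by ring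
      _ = 18 * (1 / 2) ^ l := by rw [hprod]; ring
  linarith

/-- The binary length of `n + 1`. -/
def bitLen (n : ℕ) : ℕ := Nat.log 2 (n + 1) + 1

lemma one_le_bitLen (n : ℕ) : 1 ≤ bitLen n := Nat.le_add_left 1 _

lemma succ_le_two_pow_bitLen (n : ℕ) : (n : ℝ) + 1 ≤ 2 ^ bitLen n := by
  have := (Nat.lt_pow_succ_log_self (b := 2) (by norm_num) (n + 1)).le
  exact_mod_cast this

lemma two_pow_bitLen_le (n : ℕ) : (2 : ℝ) ^ bitLen n ≤ 2 * (n + 1) := by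
  have := Nat.pow_log_le_self 2 (x := n + 1) (by omega)
  have h2 : 2 ^ bitLen n ≤ 2 * (n + 1) := by
    rw [bitLen, pow_succ]; omega
  exact_mod_cast h2

lemma tendsto_bitLen : Tendsto bitLen atTop atTop := by
  refine tendsto_atTop_mono (fun n => Nat.le_succ _) ?_
  refine tendsto_atTop.2 fun b => ?_
  filter_upwards [eventually_ge_atTop (2 ^ b)] with n hn
  exact Nat.le_log_of_pow_le (by norm_num) (by omega)

/-- With `l = bitLen n` one has `2 ^ l ≤ 2 * (n + 1)`, so the quotient is at most `√2 * l ^ j * 2 ^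
(-l / 2)`. -/
lemma tendsto_bitLen_pow_div_sqrt (j : ℕ) :
    Tendsto (fun n : ℕ => (bitLen n : ℝ) ^ j / √((n : ℝ) + 1)) atTop (𝓝 0) := by
  have h1 : Tendsto (fun l : ℕ => (l : ℝ) ^ j * √(1 / 2) ^ l) atTop (𝓝 0) := by
    refine tendsto_pow_const_mul_const_pow_of_abs_lt_one j ?_
    rw [abs_of_nonneg (Real.sqrt_nonneg _), Real.sqrt_lt' one_pos]
    norm_num
  have h2 := (h1.comp tendsto_bitLen).const_mul √2
  rw [mul_zero] at h2
  refine squeeze_zero (fun n => by positivity) (fun n => ?_) h2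
  have h3 : √(2 ^ bitLen n) ≤ √2 * √((n : ℝ) + 1) := by
    rw [← Real.sqrt_mul (by norm_num)]
    exact Real.sqrt_le_sqrt (two_pow_bitLen_le n)
  have h4 : √(2 ^ bitLen n) = √2 ^ bitLen n := by
    rw [← Real.sqrt_sq (pow_nonneg (Real.sqrt_nonneg 2) (bitLen n)), ← pow_mul, mul_comm, pow_mul,
      Real.sq_sqrt (by norm_num)]
  have h5 : √2 ^ bitLen n * √(1 / 2) ^ bitLen n = 1 := by
    rw [← mul_pow, ← Real.sqrt_mul (by norm_num)]; norm_num
  have h6 : 0 < √((n : ℝ) + 1) := Real.sqrt_pos.2 (by positivity)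
  rw [div_le_iff₀ h6]
  simp only [Function.comp]
  have h7 : 1 ≤ √2 * √(1 / 2) ^ bitLen n * √((n : ℝ) + 1) := by
    calc 1 = √2 ^ bitLen n * √(1 / 2) ^ bitLen n := h5.symm
      _ ≤ (√2 * √((n : ℝ) + 1)) * √(1 / 2) ^ bitLen n := by
        rw [← h4]
        exact mul_le_mul_of_nonneg_right h3 (pow_nonneg (Real.sqrt_nonneg _) _)
      _ = _ := by ring
  calc (bitLen n : ℝ) ^ j = (bitLen n : ℝ) ^ j * 1 := (mul_one _).symm
    _ ≤ (bitLen n : ℝ) ^ j * (√2 * √(1 / 2) ^ bitLen n * √((n : ℝ) + 1)) := by gcongr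
    _ = _ := by ring

/-- The bound on the length of paths used for the models on `n` and `n + 1` vertices. -/
def pathLen (n : ℕ) : ℕ := 2 * (650 * bitLen n ^ 2) + 1

/-- The very weak zero-one law for truncated paths. -/
lemma tendsto_truncProb_succ_sub (φ : vocabulary.Sentence) {p : ℕ → ℝ} (h0 : ∀ n, 0 ≤ p n)
    (h1 : ∀ n, p n ≤ 1) :
    Tendsto (fun n => truncProb (pathLen n) (p n) (n + 1) φ - truncProb (pathLen n) (p n) n φ)
      atTop (𝓝 0) := by
  obtain ⟨D, R, h⟩ := exists_abs_truncProb_succ_sub_le φ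
  -- `1301 = 2 * 650 + 1`, so that `k = 1301 * l ^ 2` below is at least `pathLen n`, and `20817 = 16
  -- * 1301 + 1` bounds `16 * k + 1` by `20817 * l ^ 2`.
  let C : ℝ := 2 * (1301 + R) * 20817 ^ D
  have hlim := (tendsto_bitLen_pow_div_sqrt (2 + 2 * D)).const_mul C
  rw [mul_zero] at hlim
  refine squeeze_zero_norm' ?_ hlim
  -- For such `n` one has `(2n + 3) ^ (R + 1) ≤ 2 ^ (3l(R + 1)) ≤ 2 ^ k`, so the failure term
  -- contributes at most the constant `R`.
  filter_upwards [tendsto_bitLen.eventually_ge_atTop (3 * (R + 1))] with n hn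
  have hl := one_le_bitLen n
  set l := bitLen n with hldef
  have hl' : (1 : ℝ) ≤ l := by exact_mod_cast hl
  obtain ⟨k, hkdef⟩ : ∃ k, k = 1301 * l ^ 2 := ⟨_, rfl⟩
  have hl1 : 1 ≤ l ^ 2 := Nat.one_le_pow _ _ hl
  have hk : pathLen n ≤ k := by
    unfold pathLen
    rw [← hldef]
    omega
  have hk1 : 1 ≤ k := by omega
  have hk3 : 3 * l * (R + 1) ≤ k := by nlinarith
  have hk4 : (k : ℝ) = 1301 * (l : ℝ) ^ 2 := by rw [hkdef]; push_cast; rfl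
  clear hkdef
  rw [Real.norm_eq_abs]
  refine (h n (pathLen n) k (p n) (h0 n) (h1 n) hk1 hk).trans ?_
  have hn3 : (2 * (n : ℝ) + 3) ≤ 2 ^ (3 * l) := by
    have h2 := succ_le_two_pow_bitLen n
    have h3 : (4 : ℝ) ≤ 2 ^ (2 * l) := by
      calc (4 : ℝ) = 2 ^ 2 := by norm_num
        _ ≤ 2 ^ (2 * l) := pow_le_pow_right₀ (by norm_num) (by omega)
    rw [show 3 * l = 2 * l + l by ring, pow_add]
    have h4 : (0 : ℝ) ≤ n := n.cast_nonneg
    nlinarith [mul_le_mul h3 h2 (by linarith) (by positivity)]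
  have hfail : (2 * (n : ℝ) + 3) * (R * (2 * n + 3) ^ R * (1 / 2) ^ k) ≤ R := by
    have h2 : (2 * (n : ℝ) + 3) ^ (R + 1) * (1 / 2) ^ k ≤ 1 := by
      have h3 : (2 * (n : ℝ) + 3) ^ (R + 1) ≤ 2 ^ k := by
        refine (pow_le_pow_left₀ (by positivity) hn3 _).trans ?_
        rw [← pow_mul]
        exact pow_le_pow_right₀ (by norm_num) hk3
      calc (2 * (n : ℝ) + 3) ^ (R + 1) * (1 / 2) ^ k ≤ 2 ^ k * (1 / 2) ^ k := by gcongr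
        _ = 1 := by rw [← mul_pow]; norm_num
    calc (2 * (n : ℝ) + 3) * (R * (2 * n + 3) ^ R * (1 / 2) ^ k)
        = R * ((2 * (n : ℝ) + 3) ^ (R + 1) * (1 / 2) ^ k) := by rw [pow_succ]; ring
      _ ≤ (R : ℝ) := mul_le_of_le_one_right R.cast_nonneg h2
  have hl2 : (1 : ℝ) ≤ (l : ℝ) ^ 2 := one_le_pow₀ hl'
  have hA : (k : ℝ) + (2 * n + 3) * (R * (2 * n + 3) ^ R * (1 / 2) ^ k) ≤
      (1301 + R) * (l : ℝ) ^ 2 := by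
    nlinarith [mul_le_mul_of_nonneg_left hl2 (Nat.cast_nonneg (α := ℝ) R)]
  have hB : (16 * (k : ℝ) + 1) ^ D ≤ 20817 ^ D * (l : ℝ) ^ (2 * D) := by
    rw [pow_mul, ← mul_pow]
    exact pow_le_pow_left₀ (by positivity) (by linarith) D
  rw [← mul_div_assoc]
  refine div_le_div_of_nonneg_right ?_ (Real.sqrt_nonneg _)
  calc 2 * ((k : ℝ) + (2 * n + 3) * (R * (2 * n + 3) ^ R * (1 / 2) ^ k)) * (16 * k + 1) ^ D
      ≤ 2 * ((1301 + R) * (l : ℝ) ^ 2) * (20817 ^ D * (l : ℝ) ^ (2 * D)) := by gcongr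
    _ = C * (l : ℝ) ^ (2 + 2 * D) := by rw [pow_add]; simp only [C]; ring

lemma tendsto_longProb {p : ℕ → ℝ} (hp : ∀ n : ℕ, 1 / ((n : ℝ) + 1) ≤ p n) (hp1 : ∀ n, p n ≤ 1)
    {N : ℕ → ℕ} (hN : ∀ n, N n ≤ n + 1) :
    Tendsto (fun n => longProb (pathLen n) (p n) (N n)) atTop (𝓝 0) := by
  have hlim : Tendsto (fun n : ℕ => 19 * (1 / 2 : ℝ) ^ bitLen n) atTop (𝓝 0) := by
    have := ((tendsto_pow_atTop_nhds_zero_of_lt_one (r := (1 / 2 : ℝ)) (by norm_num)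
      (by norm_num)).comp tendsto_bitLen).const_mul 19
    simpa using this
  have hp0 : ∀ n, 0 < p n := fun n => lt_of_lt_of_le (by positivity) (hp n)
  refine squeeze_zero (fun n => ?_) (fun n => ?_) hlim
  · exact expect_nonneg (fun _ => bern_nonneg (hp0 n).le (hp1 n)) fun x => ind_nonneg _
  · have h1 := succ_le_two_pow_bitLen n
    have h2 : (N n : ℝ) ≤ n + 1 := by exact_mod_cast hN n
    refine longProb_le_pow (one_le_bitLen n) (hp0 n) (hp1 n) (h2.trans h1) ?_
    have h3 : 1 / p n ≤ n + 1 := by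
      rw [div_le_iff₀ (hp0 n)]
      have := hp n
      rw [div_le_iff₀ (by positivity)] at this
      linarith
    exact h3.trans h1

/-! ### The edge probabilities and their change from `n` to `n + 1`. -/

lemma coe_edgeProb {a : ℝ} (ha : 0 < a) (n : ℕ) :
    (edgeProb a ha n : ℝ) = 1 / ((n : ℝ) + 1) ^ a := rfl

lemma tendsto_edgeProb {a : ℝ} (ha : 0 < a) :
    Tendsto (fun n => (edgeProb a ha n : ℝ)) atTop (𝓝 0) := by
  have h1 : Tendsto (fun n : ℕ => ((n : ℝ) + 1) ^ a) atTop atTop :=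
    (tendsto_rpow_atTop ha).comp (tendsto_atTop_add_const_right _ _ tendsto_natCast_atTop_atTop)
  simp only [coe_edgeProb, one_div]
  exact h1.inv_tendsto_atTop

/-- For `a ≤ 1` the ratio of consecutive probabilities is at least `(n + 1) / (n + 2)`, so the
relative change is at most `1 / (n + 2)`. -/
lemma abs_edgeProb_sub_le {a : ℝ} (ha : 0 < a) (ha1 : a ≤ 1) (n : ℕ) :
    |(edgeProb a ha n : ℝ) - edgeProb a ha (n + 1)| ≤ edgeProb a ha n / (n + 1) := by
  have hn : (0 : ℝ) < (n : ℝ) + 1 := by positivity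
  have hn2 : (0 : ℝ) < (n : ℝ) + 1 + 1 := by positivity
  simp only [coe_edgeProb]
  push_cast
  set A := ((n : ℝ) + 1) ^ a with hA
  set B := ((n : ℝ) + 1 + 1) ^ a with hB
  have hA0 : 0 < A := Real.rpow_pos_of_pos hn a
  have hAB : A ≤ B := Real.rpow_le_rpow hn.le (by linarith) ha.le
  have hB0 : 0 < B := hA0.trans_le hAB
  have hdiv : ((n : ℝ) + 1) / (n + 1 + 1) ≤ A / B := by
    rw [hA, hB, ← Real.div_rpow hn.le hn2.le]
    have h1 : ((n : ℝ) + 1) / (n + 1 + 1) ≤ 1 := by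
      rw [div_le_one hn2]; linarith
    have := Real.rpow_le_rpow_of_exponent_ge (div_pos hn hn2) h1 ha1
    rwa [Real.rpow_one] at this
  have hle : 1 / B ≤ 1 / A := one_div_le_one_div_of_le hA0 hAB
  rw [abs_of_nonneg (by linarith)]
  have h1 : 1 / A - 1 / B = 1 / A * (1 - A / B) := by field_simp
  have h2 : 1 / A / ((n : ℝ) + 1) = 1 / A * (1 / (n + 1)) := by ring
  rw [h1, h2]
  refine mul_le_mul_of_nonneg_left ?_ (by positivity)
  have h3 : 1 - ((n : ℝ) + 1) / (n + 1 + 1) = 1 / (n + 1 + 1) := by field_simp; ring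
  have h4 : 1 / ((n : ℝ) + 1 + 1) ≤ 1 / (n + 1) := one_div_le_one_div_of_le hn (by linarith)
  linarith

/-- The `(n + 1) ^ 2` coins cancel the square of the relative change `1 / (n + 1)`; what remains in
the exponent is `p / (1 - p)`, which tends to 0 with `p`. -/
lemma tendsto_bitProb_sub {a : ℝ} (ha : 0 < a) (ha1 : a ≤ 1) (φ : vocabulary.Sentence) :
    Tendsto (fun n : ℕ => bitProb (edgeProb a ha (n + 1)) (n + 1) φ -
      bitProb (edgeProb a ha n) (n + 1) φ) atTop (𝓝 0) := by
  have hp := tendsto_edgeProb ha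
  have hlim : Tendsto (fun n : ℕ =>
      √(Real.exp ((edgeProb a ha n : ℝ) / (1 - edgeProb a ha n)) - 1)) atTop (𝓝 0) := by
    have h1 := hp.div (hp.const_sub 1) (by norm_num)
    have h2 := ((Real.continuous_exp.tendsto _).comp h1).sub_const 1
    have h3 := (Real.continuous_sqrt.tendsto _).comp h2
    simp only [sub_zero, zero_div, Real.exp_zero, sub_self, Real.sqrt_zero] at h3
    exact h3
  refine squeeze_zero_norm' ?_ hlim
  filter_upwards [hp.eventually (gt_mem_nhds one_pos)] with n hn
  have hp0 : (0 : ℝ) < edgeProb a ha n := by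
    rw [coe_edgeProb]; positivity
  rw [Real.norm_eq_abs]
  refine Real.abs_le_sqrt ?_
  refine (abs_expect_bern_sub_sq_le hp0 hn _ fun x => ?_).trans ?_
  · rw [abs_of_nonneg (ind_nonneg _)]
    exact ind_le_one _
  refine sub_le_sub_right (Real.exp_le_exp.2 ?_) 1
  set p := (edgeProb a ha n : ℝ) with hpdef
  have h1 : (p - edgeProb a ha (n + 1)) ^ 2 ≤ (p / (n + 1)) ^ 2 := by
    rw [← sq_abs]
    exact pow_le_pow_left₀ (abs_nonneg _) (abs_edgeProb_sub_le ha ha1 n) 2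
  have h2 : 0 < 1 - p := by linarith
  calc (Fintype.card (Fin (n + 1) × Fin (n + 1)) : ℝ) *
        ((p - edgeProb a ha (n + 1)) ^ 2 / (p * (1 - p)))
      ≤ (Fintype.card (Fin (n + 1) × Fin (n + 1)) : ℝ) * ((p / (n + 1)) ^ 2 / (p * (1 - p))) := by
        gcongr
    _ = p / (1 - p) := by
        rw [Fintype.card_prod, Fintype.card_fin]
        push_cast
        field_simp

end RandomOrder

open RandomOrder in
theorem theorem1p6 (a : ℝ) (ha0 : 0 < a) (ha1 : a < 1) :
    RandomOrder.VeryWeakZeroOneLaw (RandomOrder.prob (RandomOrder.edgeProb a ha0)) := by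
  intro φ
  have hge : ∀ n : ℕ, 1 / ((n : ℝ) + 1) ≤ edgeProb a ha0 n := by
    intro n
    rw [coe_edgeProb]
    refine one_div_le_one_div_of_le (by positivity) ?_
    calc ((n : ℝ) + 1) ^ a ≤ ((n : ℝ) + 1) ^ (1 : ℝ) :=
          Real.rpow_le_rpow_of_exponent_le (by simp) ha1.le
      _ = n + 1 := Real.rpow_one _
  have h0 : ∀ n, (0 : ℝ) ≤ edgeProb a ha0 n := fun n => (edgeProb a ha0 n).2.1
  have h1 : ∀ n, (edgeProb a ha0 n : ℝ) ≤ 1 := fun n => (edgeProb a ha0 n).2.2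
  have hlong : ∀ {N : ℕ → ℕ}, (∀ n, N n ≤ n + 1) → Tendsto (fun n =>
      bitProb (edgeProb a ha0 n) (N n) φ - truncProb (pathLen n) (edgeProb a ha0 n) (N n) φ)
        atTop (𝓝 0) := fun hN =>
    squeeze_zero_norm (fun n => abs_bitProb_sub_truncProb_le (h0 n) (h1 n) φ)
      (tendsto_longProb hge h1 hN)
  -- The increment telescopes: change the edge probability at size `n + 1`, truncate paths, delete a
  -- vertex, undo the truncation at size `n`. The last three steps all use the edge probability for
  -- `n` and the same path length.
  have hsum := (((tendsto_bitProb_sub ha0 ha1.le φ).add (hlong fun n => le_rfl)).add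
    (tendsto_truncProb_succ_sub φ h0 h1)).sub (hlong fun n => Nat.le_succ n)
  simp only [add_zero, sub_zero] at hsum
  refine hsum.congr fun n => ?_
  rw [prob_eq_expect, prob_eq_expect]
  simp only [bitProb]
  ring
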